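/- Let $\Bbbk$ be an infinite field and let $n,m,k$ be integers with $m\ge 1$ and $0<k<n$. Let $Q_{n,m}$ be the quiver with two vertices $\mathbf 1,\mathbf 2$, with $n$ arrows $c_1,\dots,c_n$ from $\mathbf 1$ to $\mathbf 2$ and $m$ arrows $b_1,\dots,b_m$ from $\mathbf 2$ to $\mathbf 1$; in its path algebra $\Bbbk Q_{n,m}$ paths are multiplied like maps, from right to left. Let $B$ and $C$ be the vector spaces with bases $b_1,\dots,b_m$ and $c_1,\dots,c_n$. Let $\mathfrak F=\{V_1,\dots,V_m;W_1,\dots,W_m\}$ be a family of subspaces of $C$ with $\dim V_i=k$ and $\operatorname{codim} W_i=k$ for all $i$. Let $I_{\mathfrak F}\subset \Bbbk Q_{n,m}$ be the two-sided ideal generated by the elements \[ bcb'\ (b,b'\in B,\ c\in C),\qquad wb_i\ (w\in W_i,\ 1\le i\le m),\qquad b_iv\ (v\in V_i,\ 1\le i\le m), \] and put $R_{\mathfrak F}=\Bbbk Q_{n,m}/I_{\mathfrak F}$. Let $\Gamma_{\mathfrak F}$ be the quiver with $2m$ vertices $b_1,\dots,b_m,v_1,\dots,v_m$, with one arrow $b_i\to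 v_i$ for each $i$, and with $t_{ij}=\dim(V_i\cap W_j)$ arrows $b_i\to b_j$ and $t_{ij}$ arrows $v_i\to b_j$ for each pair $i,j$. Then $R_{\mathfrak F}$ has finite global dimension (the supremum of the projective dimensions of all right modules) if and only if $\Gamma_{\mathfrak F}$ has no oriented cycles. In that case, the lengths of the paths in $\Gamma_{\mathfrak F}$ have a maximum $l$, and the global dimension of $R_{\mathfrak F}$ is equal to $l+2$. -/

import Mathlib

open CategoryTheory

universe u v w

/-! ### Path algebras -/

/-- Generators of the path algebra: one idempotent for each vertex, and the arrows. -/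
inductive PathAlgebraGen (Q : Type v) [Quiver.{w} Q] : Type (max v w)
  | idem (q : Q) : PathAlgebraGen Q
  | arrow {p q : Q} (a : p ⟶ q) : PathAlgebraGen Q

section PathAlgebra

variable (𝕜 : Type u) [Field 𝕜] (Q : Type v) [Quiver.{w} Q] [Fintype Q]

/-- Defining relations of the path algebra. For an arrow `a : p ⟶ q` (source `p`, target `q`) one
has `e_q a = a = a e_p`, so that paths are multiplied like maps, from right to left. -/
inductive PathAlgebraRel :
    FreeAlgebra 𝕜 (PathAlgebraGen Q) → FreeAlgebra 𝕜 (PathAlgebraGen Q) → Prop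
  | idem_mul_self (q : Q) : PathAlgebraRel
      (FreeAlgebra.ι 𝕜 (PathAlgebraGen.idem q) * FreeAlgebra.ι 𝕜 (PathAlgebraGen.idem q))
      (FreeAlgebra.ι 𝕜 (PathAlgebraGen.idem q))
  | idem_mul_idem (p q : Q) (h : p ≠ q) : PathAlgebraRel
      (FreeAlgebra.ι 𝕜 (PathAlgebraGen.idem p) * FreeAlgebra.ι 𝕜 (PathAlgebraGen.idem q)) 0
  | target_mul {p q : Q} (a : p ⟶ q) : PathAlgebraRel
      (FreeAlgebra.ι 𝕜 (PathAlgebraGen.idem q) * FreeAlgebra.ι 𝕜 (PathAlgebraGen.arrow a))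
      (FreeAlgebra.ι 𝕜 (PathAlgebraGen.arrow a))
  | mul_source {p q : Q} (a : p ⟶ q) : PathAlgebraRel
      (FreeAlgebra.ι 𝕜 (PathAlgebraGen.arrow a) * FreeAlgebra.ι 𝕜 (PathAlgebraGen.idem p))
      (FreeAlgebra.ι 𝕜 (PathAlgebraGen.arrow a))
  | sum_idem : PathAlgebraRel (∑ q : Q, FreeAlgebra.ι 𝕜 (PathAlgebraGen.idem q)) 1

/-- The path algebra `𝕜Q` of a quiver with finitely many vertices. -/
abbrev PathAlgebra : Type (max u v w) := RingQuot (PathAlgebraRel 𝕜 Q)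

variable {Q}

/-- The element of the path algebra given by an arrow. -/
def PathAlgebra.arrow {p q : Q} (a : p ⟶ q) : PathAlgebra 𝕜 Q :=
  RingQuot.mkAlgHom 𝕜 (PathAlgebraRel 𝕜 Q) (FreeAlgebra.ι 𝕜 (PathAlgebraGen.arrow a))

end PathAlgebra

/-! ### The quiver `Q_{n,m}` -/

/-- The two vertices of `Q_{n,m}`. -/
inductive QVertex (n m : ℕ) : Type
  | one : QVertex n m
  | two : QVertex n m

instance (n m : ℕ) : Fintype (QVertex n m) :=
  ⟨⟨{QVertex.one, QVertex.two}, by simp⟩, by rintro (_ | _) <;> simp⟩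

/-- The arrows of `Q_{n,m}`: `c_1, …, c_n` from `1` to `2`, and `b_1, …, b_m` from `2` to `1`. -/
inductive QArrow (n m : ℕ) : QVertex n m → QVertex n m → Type
  | c (j : Fin n) : QArrow n m QVertex.one QVertex.two
  | b (i : Fin m) : QArrow n m QVertex.two QVertex.one

instance (n m : ℕ) : Quiver (QVertex n m) := ⟨QArrow n m⟩

section RF

variable (𝕜 : Type u) [Field 𝕜] {n m : ℕ}

/-- The arrow `b_i` as an element of `𝕜Q_{n,m}`. -/
def bGen (i : Fin m) : PathAlgebra 𝕜 (QVertex n m) :=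
  PathAlgebra.arrow 𝕜 (p := QVertex.two) (q := QVertex.one) (QArrow.b i)

/-- The arrow `c_j` as an element of `𝕜Q_{n,m}`. -/
def cGen (j : Fin n) : PathAlgebra 𝕜 (QVertex n m) :=
  PathAlgebra.arrow 𝕜 (p := QVertex.one) (q := QVertex.two) (QArrow.c j)

variable {𝕜}

/-- The element `∑ y_i b_i` of the space `B` spanned by the arrows `b_i`. -/
def bVec (y : Fin m → 𝕜) : PathAlgebra 𝕜 (QVertex n m) := ∑ i, y i • bGen 𝕜 i

/-- The element `∑ x_j c_j` of the space `C` spanned by the arrows `c_j`; in this way `C` is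
identified with `𝕜ⁿ`. -/
def cVec (x : Fin n → 𝕜) : PathAlgebra 𝕜 (QVertex n m) := ∑ j, x j • cGen 𝕜 j

variable (V W : Fin m → Submodule 𝕜 (Fin n → 𝕜))

/-- The relations `b c b' = 0`, `w b_i = 0` for `w ∈ W_i`, and `b_i v = 0` for `v ∈ V_i`. -/
inductive FamilyRelation : PathAlgebra 𝕜 (QVertex n m) → Prop
  | bcb (y y' : Fin m → 𝕜) (x : Fin n → 𝕜) : FamilyRelation (bVec y * cVec x * bVec y')
  | wb (i : Fin m) (x : Fin n → 𝕜) (hx : x ∈ W i) : FamilyRelation (cVec x * bGen 𝕜 i)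
  | bv (i : Fin m) (x : Fin n → 𝕜) (hx : x ∈ V i) : FamilyRelation (bGen 𝕜 i * cVec x)

/-- The two-sided ideal `I_F` generated by these relations. -/
def familyIdeal : TwoSidedIdeal (PathAlgebra 𝕜 (QVertex n m)) :=
  TwoSidedIdeal.span {r | FamilyRelation V W r}

/-- The algebra `R_F = 𝕜Q_{n,m} / I_F`. -/
abbrev FamilyAlgebra : Type u := (familyIdeal V W).ringCon.Quotient

end RF

/-! ### The quiver `Γ_F` -/

section Gamma

variable {𝕜 : Type u} [Field 𝕜] {n m : ℕ}

/-- The `2m` vertices `b_1, …, b_m, v_1, …, v_m` of `Γ_F`. -/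
inductive GammaVertex (V W : Fin m → Submodule 𝕜 (Fin n → 𝕜)) : Type
  | b (i : Fin m) : GammaVertex V W
  | v (i : Fin m) : GammaVertex V W

/-- The arrows of `Γ_F`: one arrow `b_i → v_i`, and `dim (V_i ∩ W_j)` arrows `b_i → b_j` and
`v_i → b_j` each. -/
inductive GammaArrow (V W : Fin m → Submodule 𝕜 (Fin n → 𝕜)) :
    GammaVertex V W → GammaVertex V W → Type
  | bv (i : Fin m) : GammaArrow V W (GammaVertex.b i) (GammaVertex.v i)
  | bb (i j : Fin m) (s : Fin (Module.finrank 𝕜 (V i ⊓ W j : Submodule 𝕜 (Fin n → 𝕜)))) :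
      GammaArrow V W (GammaVertex.b i) (GammaVertex.b j)
  | vb (i j : Fin m) (s : Fin (Module.finrank 𝕜 (V i ⊓ W j : Submodule 𝕜 (Fin n → 𝕜)))) :
      GammaArrow V W (GammaVertex.v i) (GammaVertex.b j)

instance (V W : Fin m → Submodule 𝕜 (Fin n → 𝕜)) : Quiver (GammaVertex V W) := ⟨GammaArrow V W⟩

end Gamma

/-- A quiver has no oriented cycles: no path of positive length returns to its source. -/
def NoOrientedCycles (Q : Type v) [Quiver.{w} Q] : Prop :=
  ∀ (q : Q) (p : Quiver.Path q q), p.length = 0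

/-- The set of lengths of the paths of a quiver. -/
def pathLengths (Q : Type v) [Quiver.{w} Q] : Set ℕ :=
  {l | ∃ (p q : Q) (γ : Quiver.Path p q), γ.length = l}

/-- The (right) global dimension of a ring: the supremum of the projective dimensions of all right
modules, that is, of all modules over the opposite ring. -/
noncomputable def globalDimension (R : Type u) [Ring R] : WithBot ℕ∞ :=
  ⨆ M : ModuleCat.{u} Rᵐᵒᵖ, projectiveDimension M

open TensorProduct MulOpposite

/-!
Right `R_F`-modules are left modules over `FamilyOp V W`, the opposite of `R_F`. By
`FamilyOp.induction` such a module is a vector space with operators for the generators, subject to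
the defining relations (`RightRep`), and submodules and linear maps can be checked on generators.

Write `M_j = b_j R_F`. Its underlying space is `𝕜 b_j ⊕ b_j C ≅ 𝕜 × C/V_j`, because `b c b' = 0`
and `b_j V_j = 0` (`BMod`). All other modules that matter are built from spaces `Y`, `T`, `X_j`
with maps `C → Hom(Y, T)` and `π_j : T → X_j`: the module `GMod` is `Y × T × ∏ j, M_j ⊗ X_j`, with
`Y` at the vertex `2` and `T` at the vertex `1`, where `b_j` sends `t` to `b_j ⊗ π_j t`. The
indecomposable projectives `e_1 R_F` and `e_2 R_F` are of this form (`ProjOne`, `ProjTwo`); this is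
where the relations `w b_i = 0` enter. The construction is exact in the linear data, so that
syzygies can be read off from kernels of linear maps:

* the first syzygy of the module of `T` and surjective maps `π_j` is `∏ j, M_j ⊗ ker π_j`
  (`PdLT.starMod`, `PdLT.starMod_kernel`);
* the first syzygy of `M_i` is the module `K_i` of the maps `V_i → C/W_j` (`PdLT.bMod`,
  `PdLT.bMod_kernel`). It is the direct sum of the module `N_i` of the maps of `V_i` onto its images
  in the `C/W_j`, and of `dim coker (V_i → C/W_j)` copies of each `M_j`.

Since `dim V_i = dim C/W_j = k`, kernel and cokernel of `V_i → C/W_j` both have the dimension `t_ij`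
of `V_i ∩ W_j`. Hence the syzygy of `M_i` is `N_i ⊕ ⨁ j, M_j ^ t_ij`, and that of `N_i` is
`⨁ j, M_j ^ t_ij`: the summands are the targets of the arrows of `Γ_F` from `b_i` and from `v_i`. As
`M_i` is never projective, and `N_i` only if no arrow starts at `v_i`, the projective dimension of
the module at a vertex is the supremum of the lengths of the paths that start there
(`not_nodePdLT_of_path`, `nodePdLT_of_forall_path`).

Finally, the second syzygy of the simple module at the vertex `2` is `∏ j, M_j ⊗ W_j` with
`W_j ≠ 0`, so its projective dimension exceeds the maximum for the `M_j` by two (`le_globalDimension`), and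
every module has a filtration whose factors are sums of copies of the two simple modules, so that no
module exceeds this bound (`globalDimension_le`). A longest path starts at some `b_i`, because `v_i`
is the target of the arrow from `b_i`.
-/

/-! ### Generators and relations of the opposite algebra -/

section Generators

lemma QVertex.sum_univ {n m : ℕ} {A : Type*} [AddCommMonoid A] (f : QVertex n m → A) :
    ∑ q, f q = f .one + f .two := by
  change (Multiset.map f {QVertex.one, QVertex.two}).sum = _
  simp

variable {𝕜 : Type u} [Field 𝕜] {n m : ℕ} (V W : Fin m → Submodule 𝕜 (Fin n → 𝕜))

/-- The opposite `R_Fᵐᵒᵖ` of the family algebra. Its left modules are the right `R_F`-modules, and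
its product is that of `R_F` in the reverse order. -/
abbrev FamilyOp : Type u := (FamilyAlgebra V W)ᵐᵒᵖ

/-- The residue class in `R_Fᵐᵒᵖ` of an element of the path algebra. -/
def famMk : PathAlgebra 𝕜 (QVertex n m) →ₗ[𝕜] FamilyOp V W :=
  (opLinearEquiv 𝕜).toLinearMap ∘ₗ ((familyIdeal V W).ringCon.mkₐ 𝕜).toLinearMap

/-- The idempotent of a vertex, as an element of `R_Fᵐᵒᵖ`. -/
def famE (q : QVertex n m) : FamilyOp V W :=
  famMk V W (RingQuot.mkAlgHom 𝕜 (PathAlgebraRel 𝕜 (QVertex n m))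
    (FreeAlgebra.ι 𝕜 (PathAlgebraGen.idem q)))

/-- The arrow `b_i`, as an element of `R_Fᵐᵒᵖ`. -/
def famB (i : Fin m) : FamilyOp V W := famMk V W (bGen 𝕜 i)

/-- The space `C` of arrows, mapped to `R_Fᵐᵒᵖ`. -/
def famC : (Fin n → 𝕜) →ₗ[𝕜] FamilyOp V W where
  toFun x := famMk V W (cVec x)
  map_add' x y := by
    simp only [cVec, Pi.add_apply, add_smul, Finset.sum_add_distrib, map_add]
  map_smul' a x := by
    simp only [cVec, Pi.smul_apply, smul_eq_mul, mul_smul, ← Finset.smul_sum, map_smul,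
      RingHom.id_apply]

variable {V W}

lemma famMk_mul (x y : PathAlgebra 𝕜 (QVertex n m)) :
    famMk V W (x * y) = famMk V W y * famMk V W x :=
  rfl

lemma famMk_one : famMk V W 1 = 1 := rfl

lemma famMk_eq_zero {x : PathAlgebra 𝕜 (QVertex n m)} (h : FamilyRelation V W x) :
    famMk V W x = 0 := by
  have h1 : x ∈ familyIdeal V W := TwoSidedIdeal.subset_span h
  have h2 : (familyIdeal V W).ringCon.mkₐ 𝕜 x = (familyIdeal V W).ringCon.mkₐ 𝕜 0 :=
    (RingCon.eq _).2 h1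
  exact congrArg op h2

lemma famE_add : famE V W .one + famE V W .two = 1 := by
  have h := RingQuot.mkAlgHom_rel 𝕜 (PathAlgebraRel.sum_idem (𝕜 := 𝕜) (Q := QVertex n m))
  rw [QVertex.sum_univ, map_add, map_one] at h
  rw [famE, famE, ← map_add, h, famMk_one]

lemma famE_one_mul_two : famE V W .one * famE V W .two = 0 := by
  have h := RingQuot.mkAlgHom_rel 𝕜
    (PathAlgebraRel.idem_mul_idem (𝕜 := 𝕜) (Q := QVertex n m) .two .one (by simp))
  rw [map_mul, map_zero] at h
  rw [famE, famE, ← famMk_mul, h, map_zero]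

lemma famE_two_mul_one : famE V W .two * famE V W .one = 0 := by
  have h := RingQuot.mkAlgHom_rel 𝕜
    (PathAlgebraRel.idem_mul_idem (𝕜 := 𝕜) (Q := QVertex n m) .one .two (by simp))
  rw [map_mul, map_zero] at h
  rw [famE, famE, ← famMk_mul, h, map_zero]

lemma famE_two_mul_famB (i : Fin m) : famE V W .two * famB V W i = famB V W i := by
  have h := RingQuot.mkAlgHom_rel 𝕜
    (PathAlgebraRel.mul_source (𝕜 := 𝕜) (Q := QVertex n m) (QArrow.b i))
  rw [map_mul] at h
  rw [famE, famB, ← famMk_mul]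
  exact congrArg (famMk V W) h

lemma famB_mul_famE_one (i : Fin m) : famB V W i * famE V W .one = famB V W i := by
  have h := RingQuot.mkAlgHom_rel 𝕜
    (PathAlgebraRel.target_mul (𝕜 := 𝕜) (Q := QVertex n m) (QArrow.b i))
  rw [map_mul] at h
  rw [famE, famB, ← famMk_mul]
  exact congrArg (famMk V W) h

lemma famE_one_mul_famC (x : Fin n → 𝕜) : famE V W .one * famC V W x = famC V W x := by
  have h (j : Fin n) := RingQuot.mkAlgHom_rel 𝕜
    (PathAlgebraRel.mul_source (𝕜 := 𝕜) (Q := QVertex n m) (QArrow.c j))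
  simp only [map_mul] at h
  change famE V W .one * famMk V W (cVec x) = famMk V W (cVec x)
  rw [famE, ← famMk_mul, cVec, Finset.sum_mul]
  congr 1
  refine Finset.sum_congr rfl fun j _ => ?_
  rw [smul_mul_assoc]
  exact congrArg (x j • ·) (h j)

lemma famC_mul_famE_two (x : Fin n → 𝕜) : famC V W x * famE V W .two = famC V W x := by
  have h (j : Fin n) := RingQuot.mkAlgHom_rel 𝕜
    (PathAlgebraRel.target_mul (𝕜 := 𝕜) (Q := QVertex n m) (QArrow.c j))
  simp only [map_mul] at h
  change famMk V W (cVec x) * famE V W .two = famMk V W (cVec x)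
  rw [famE, ← famMk_mul, cVec, Finset.mul_sum]
  congr 1
  refine Finset.sum_congr rfl fun j _ => ?_
  rw [mul_smul_comm]
  exact congrArg (x j • ·) (h j)

lemma bVec_single (i : Fin m) : bVec (n := n) (Pi.single i (1 : 𝕜)) = bGen 𝕜 i := by
  simp [bVec, Pi.single_apply, ite_smul]

lemma famB_mul_famC_mul_famB (i j : Fin m) (x : Fin n → 𝕜) :
    famB V W j * famC V W x * famB V W i = 0 := by
  have h := famMk_eq_zero (FamilyRelation.bcb (V := V) (W := W)
    (Pi.single i 1) (Pi.single j 1) x)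
  rwa [famMk_mul, famMk_mul, bVec_single, bVec_single, ← mul_assoc] at h

lemma famB_mul_famC {i : Fin m} {x : Fin n → 𝕜} (hx : x ∈ W i) :
    famB V W i * famC V W x = 0 := by
  have h := famMk_eq_zero (FamilyRelation.wb (V := V) (W := W) i x hx)
  rwa [famMk_mul] at h

lemma famC_mul_famB {i : Fin m} {x : Fin n → 𝕜} (hx : x ∈ V i) :
    famC V W x * famB V W i = 0 := by
  have h := famMk_eq_zero (FamilyRelation.bv (V := V) (W := W) i x hx)
  rwa [famMk_mul] at h

/-- A property of elements of `R_Fᵐᵒᵖ` that is inherited by sums and products holds everywhere if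
it holds for scalars and generators. -/
theorem FamilyOp.induction {P : FamilyOp V W → Prop} (algebraMap : ∀ a : 𝕜, P (algebraMap 𝕜 _ a))
    (add : ∀ s t, P s → P t → P (s + t)) (mul : ∀ s t, P s → P t → P (s * t))
    (e : ∀ q, P (famE V W q)) (b : ∀ i, P (famB V W i)) (c : ∀ x, P (famC V W x))
    (s : FamilyOp V W) : P s := by
  obtain ⟨r, rfl⟩ := op_surjective s
  obtain ⟨x, rfl⟩ := RingCon.mkₐ_surjective (α := 𝕜) (familyIdeal V W).ringCon r
  obtain ⟨f, rfl⟩ := RingQuot.mkAlgHom_surjective 𝕜 (PathAlgebraRel 𝕜 (QVertex n m)) x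
  induction f using FreeAlgebra.induction with
  | grade0 a => simpa only [AlgHom.commutes] using! algebraMap a
  | grade1 g =>
    rcases g with q | @⟨_, _, _ | _⟩
    · exact e q
    · rename_i j
      have h := c (Pi.single j 1)
      have h2 : cVec (m := m) (Pi.single j (1 : 𝕜)) = cGen 𝕜 j := by
        simp [cVec, Pi.single_apply, ite_smul]
      change P (famMk V W _) at h
      rwa [h2] at h
    · exact b _
  | mul f g hf hg => simpa only [map_mul, op_mul] using mul _ _ hg hf
  | add f g hf hg => rw [map_add, map_add]; exact add _ _ hf hg

end Generators

/-! ### Right modules as systems of operators -/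

section RightRep

variable {𝕜 : Type u} [Field 𝕜] {n m : ℕ} (V W : Fin m → Submodule 𝕜 (Fin n → 𝕜))

/-- The structure of a right `R_F`-module on the vector space `X`, given by the operators by which
the generators of `R_F` act. The field names of the relations list the operators in the order in
which they are applied. -/
structure RightRep (X : Type u) [AddCommGroup X] [Module 𝕜 X] where
  /-- action of the idempotents -/
  e : QVertex n m → Module.End 𝕜 X
  /-- action of the arrows `b_i` -/
  b : Fin m → Module.End 𝕜 X
  /-- action of the space `C` of arrows -/
  c : (Fin n → 𝕜) →ₗ[𝕜] Module.End 𝕜 X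
  e_add : ∀ x, e .one x + e .two x = x
  e_two_e_one : ∀ x, e .one (e .two x) = 0
  e_one_e_two : ∀ x, e .two (e .one x) = 0
  c_e_two : ∀ y x, e .two (c y x) = 0
  e_one_c : ∀ y x, c y (e .one x) = 0
  b_e_one : ∀ i x, e .one (b i x) = 0
  e_two_b : ∀ i x, b i (e .two x) = 0
  b_c_b : ∀ i j y x, b j (c y (b i x)) = 0
  w_b : ∀ i, ∀ y ∈ W i, ∀ x, b i (c y x) = 0
  b_v : ∀ i, ∀ y ∈ V i, ∀ x, c y (b i x) = 0

variable {V W}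

namespace RightRep

variable {X : Type u} [AddCommGroup X] [Module 𝕜 X] (ρ : RightRep V W X)

/-- The operators of the generators of the path algebra. -/
def genOp : PathAlgebraGen (QVertex n m) → (Module.End 𝕜 X)ᵐᵒᵖ
  | .idem q => op (ρ.e q)
  | .arrow (QArrow.c j) => op (ρ.c (Pi.single j 1))
  | .arrow (QArrow.b i) => op (ρ.b i)

lemma e_one_e_one (x : X) : ρ.e .one (ρ.e .one x) = ρ.e .one x := by
  simpa [ρ.e_one_e_two] using ρ.e_add (ρ.e .one x)

lemma e_two_e_two (x : X) : ρ.e .two (ρ.e .two x) = ρ.e .two x := by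
  simpa [ρ.e_two_e_one] using ρ.e_add (ρ.e .two x)

lemma c_e_one (y : Fin n → 𝕜) (x : X) : ρ.e .one (ρ.c y x) = ρ.c y x := by
  simpa [ρ.c_e_two] using ρ.e_add (ρ.c y x)

lemma e_two_c (y : Fin n → 𝕜) (x : X) : ρ.c y (ρ.e .two x) = ρ.c y x := by
  conv_rhs => rw [← ρ.e_add x, map_add, ρ.e_one_c, zero_add]

lemma b_e_two (i : Fin m) (x : X) : ρ.e .two (ρ.b i x) = ρ.b i x := by
  simpa [ρ.b_e_one] using ρ.e_add (ρ.b i x)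

lemma e_one_b (i : Fin m) (x : X) : ρ.b i (ρ.e .one x) = ρ.b i x := by
  conv_rhs => rw [← ρ.e_add x, map_add, ρ.e_two_b, add_zero]

/-- The action of the path algebra. -/
noncomputable def pathHom : PathAlgebra 𝕜 (QVertex n m) →ₐ[𝕜] (Module.End 𝕜 X)ᵐᵒᵖ :=
  RingQuot.liftAlgHom 𝕜 ⟨FreeAlgebra.lift 𝕜 ρ.genOp, by
    intro x y h
    induction h with
    | idem_mul_self q =>
      simp only [map_mul, FreeAlgebra.lift_ι_apply, genOp, ← op_mul]
      congr 1; ext x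
      cases q
      exacts [ρ.e_one_e_one x, ρ.e_two_e_two x]
    | idem_mul_idem p q h =>
      simp only [map_mul, FreeAlgebra.lift_ι_apply, genOp, ← op_mul, map_zero]
      rw [← op_zero]
      congr 1; ext x
      rcases p with _ | _ <;> rcases q with _ | _
      exacts [(h rfl).elim, ρ.e_one_e_two x, ρ.e_two_e_one x, (h rfl).elim]
    | target_mul a =>
      rcases a with _ | _
      all_goals
        simp only [map_mul, FreeAlgebra.lift_ι_apply, genOp, ← op_mul]
        congr 1; ext x
      exacts [ρ.e_two_c _ _, ρ.e_one_b _ _]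
    | mul_source a =>
      rcases a with _ | _
      all_goals
        simp only [map_mul, FreeAlgebra.lift_ι_apply, genOp, ← op_mul]
        congr 1; ext x
      exacts [ρ.c_e_one _ _, ρ.b_e_two _ _]
    | sum_idem =>
      rw [QVertex.sum_univ]
      simp only [map_add, map_one, FreeAlgebra.lift_ι_apply, genOp]
      exact congrArg op (LinearMap.ext ρ.e_add)⟩

lemma pathHom_e (q : QVertex n m) : ρ.pathHom (RingQuot.mkAlgHom 𝕜 (PathAlgebraRel 𝕜 (QVertex n m))
    (FreeAlgebra.ι 𝕜 (PathAlgebraGen.idem q))) = op (ρ.e q) := by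
  simp [pathHom, genOp]

lemma pathHom_bGen (i : Fin m) : ρ.pathHom (bGen 𝕜 i) = op (ρ.b i) := by
  simp [pathHom, genOp, bGen, PathAlgebra.arrow]

lemma pathHom_bVec (y : Fin m → 𝕜) : ρ.pathHom (bVec y) = op (∑ i, y i • ρ.b i) := by
  simp [bVec, pathHom_bGen]

lemma pathHom_cVec (y : Fin n → 𝕜) : ρ.pathHom (cVec y) = op (ρ.c y) := by
  have h (j : Fin n) : ρ.pathHom (cGen 𝕜 j) = op (ρ.c (Pi.single j 1)) := by
    simp [pathHom, genOp, cGen, PathAlgebra.arrow]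
  simp only [cVec, map_sum, map_smul, h]
  conv_rhs => rw [← Finset.univ_sum_single y, map_sum]
  simp only [← op_smul, ← map_smul, ← Pi.single_smul, smul_eq_mul, mul_one]
  exact (map_sum (opAddEquiv : Module.End 𝕜 X ≃+ _) _ _).symm

lemma pathHom_eq_zero {x : PathAlgebra 𝕜 (QVertex n m)} (hx : x ∈ familyIdeal V W) :
    ρ.pathHom x = 0 := by
  suffices familyIdeal V W ≤ TwoSidedIdeal.ker ρ.pathHom from
    (TwoSidedIdeal.mem_ker _).1 (this hx)
  refine TwoSidedIdeal.span_le.2 fun x hx => (TwoSidedIdeal.mem_ker _).2 ?_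
  induction hx with
  | bcb y y' z =>
    rw [map_mul, map_mul, pathHom_bVec, pathHom_bVec, pathHom_cVec, ← op_mul, ← op_mul, ← op_zero]
    congr 1; ext x
    simp [ρ.b_c_b]
  | wb i y hy =>
    rw [map_mul, pathHom_bGen, pathHom_cVec, ← op_mul, ← op_zero]
    congr 1; ext x
    exact ρ.w_b i y hy x
  | bv i y hy =>
    rw [map_mul, pathHom_bGen, pathHom_cVec, ← op_mul, ← op_zero]
    congr 1; ext x
    exact ρ.b_v i y hy x

/-- The action of the opposite of the family algebra. -/
noncomputable def hom : FamilyOp V W →ₐ[𝕜] Module.End 𝕜 X :=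
  AlgHom.opComm ((familyIdeal V W).ringCon.liftₐ ρ.pathHom fun x y h => by
    have h1 := ρ.pathHom_eq_zero (((familyIdeal V W).rel_iff x y).1 h)
    rw [map_sub, sub_eq_zero] at h1
    exact h1)

/-- The vector space `X` with the right module structure given by a representation. -/
@[nolint unusedArguments]
def Carrier (_ : RightRep V W X) : Type u := X

instance instAddCommGroup : AddCommGroup ρ.Carrier := inferInstanceAs (AddCommGroup X)
instance instModule : Module 𝕜 ρ.Carrier := inferInstanceAs (Module 𝕜 X)
noncomputable instance instModuleOp : Module (FamilyOp V W) ρ.Carrier :=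
  Module.compHom X ρ.hom.toRingHom

lemma smul_def (s : FamilyOp V W) (x : ρ.Carrier) : s • x = ρ.hom s x := rfl

instance instIsScalarTower : IsScalarTower 𝕜 (FamilyOp V W) ρ.Carrier where
  smul_assoc a s x := by
    rw [smul_def, smul_def, map_smul]; rfl

lemma famE_smul (q : QVertex n m) (x : ρ.Carrier) : famE V W q • x = ρ.e q x := by
  change (ρ.pathHom _).unop x = _
  rw [pathHom_e]; rfl

lemma famB_smul (i : Fin m) (x : ρ.Carrier) : famB V W i • x = ρ.b i x := by
  change (ρ.pathHom _).unop x = _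
  rw [pathHom_bGen]; rfl

lemma famC_smul (y : Fin n → 𝕜) (x : ρ.Carrier) : famC V W y • x = ρ.c y x := by
  change (ρ.pathHom _).unop x = _
  rw [pathHom_cVec]; rfl

end RightRep

end RightRep

/-! ### Projective dimension of modules -/

section ProjDim

/-- The `S`-module `M` has projective dimension less than `d`. -/
def PdLT (S : Type u) [Ring S] (M : Type u) [AddCommGroup M] [Module S M] (d : ℕ) : Prop :=
  HasProjectiveDimensionLT (ModuleCat.of S M) d

variable {S : Type u} [Ring S]
variable {A B C : Type u} [AddCommGroup A] [AddCommGroup B] [AddCommGroup C]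
  [Module S A] [Module S B] [Module S C]

lemma PdLT.mono {d d' : ℕ} (h : PdLT S A d) (hd : d ≤ d') : PdLT S A d' :=
  haveI : HasProjectiveDimensionLT (ModuleCat.of S A) d := h
  hasProjectiveDimensionLT_of_ge _ d d' hd

lemma pdLT_zero_iff : PdLT S A 0 ↔ Subsingleton A := by
  rw [PdLT, hasProjectiveDimensionLT_zero_iff_isZero, ModuleCat.isZero_iff_subsingleton]

lemma PdLT.of_subsingleton [Subsingleton A] (d : ℕ) : PdLT S A d :=
  (pdLT_zero_iff.2 ‹_›).mono d.zero_le

lemma pdLT_one_iff : PdLT S A 1 ↔ Module.Projective S A := by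
  rw [PdLT, ← projective_iff_hasProjectiveDimensionLT_one, ← IsProjective.iff_projective]

lemma PdLT.of_retract {d : ℕ} (i : A →ₗ[S] B) (r : B →ₗ[S] A) (hri : ∀ a, r (i a) = a)
    (h : PdLT S B d) : PdLT S A d :=
  haveI : HasProjectiveDimensionLT (ModuleCat.of S B) d := h
  Retract.hasProjectiveDimensionLT (X := ModuleCat.of S A) (Y := ModuleCat.of S B)
    ⟨ModuleCat.ofHom i, ModuleCat.ofHom r, by ext a; exact hri a⟩ d

lemma PdLT.of_equiv {d : ℕ} (e : A ≃ₗ[S] B) (h : PdLT S B d) : PdLT S A d :=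
  h.of_retract e.toLinearMap e.symm.toLinearMap e.symm_apply_apply

section Exact

variable {f : A →ₗ[S] B} {g : B →ₗ[S] C} (hf : Function.Injective f) (hfg : Function.Exact f g)
  (hg : Function.Surjective g)
include hf hfg hg

lemma shortExact_of_linearMap :
    (ShortComplex.mk (ModuleCat.ofHom f) (ModuleCat.ofHom g) (by
      ext x; exact hfg.apply_apply_eq_zero x)).ShortExact where
  exact := (ShortComplex.ShortExact.moduleCat_exact_iff_function_exact _).2 hfg
  mono_f := (ModuleCat.mono_iff_injective _).2 hf
  epi_g := (ModuleCat.epi_iff_surjective _).2 hg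

lemma PdLT.middle {d : ℕ} (hA : PdLT S A d) (hC : PdLT S C d) : PdLT S B d :=
  (shortExact_of_linearMap hf hfg hg).hasProjectiveDimensionLT_X₂ d hA hC

/-- If the first syzygy `A` of `C` has projective dimension less than `d`, then `C` has projective
dimension less than `d + 1`. -/
lemma PdLT.right {d : ℕ} (hA : PdLT S A d) (hB : Module.Projective S B) : PdLT S C (d + 1) :=
  (shortExact_of_linearMap hf hfg hg).hasProjectiveDimensionLT_X₃ d hA
    ((pdLT_one_iff.2 hB).mono (by lia))

/-- A partial converse of `PdLT.right`. It fails for `PdLT S C 1`, where `A` is projective but need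
not be zero. -/
lemma PdLT.left {d : ℕ} (hC : PdLT S C (d + 2)) (hB : Module.Projective S B) : PdLT S A (d + 1) :=
  (shortExact_of_linearMap hf hfg hg).hasProjectiveDimensionLT_X₁ (d + 1)
    ((pdLT_one_iff.2 hB).mono (by lia)) hC

end Exact

lemma PdLT.prod {d : ℕ} (hA : PdLT S A d) (hB : PdLT S B d) : PdLT S (A × B) d :=
  PdLT.middle (f := LinearMap.inl S A B) (g := LinearMap.snd S A B) LinearMap.inl_injective
    Function.Exact.inl_snd LinearMap.snd_surjective hA hB

lemma PdLT.pi {d l : ℕ} {M : Fin l → Type u} [∀ i, AddCommGroup (M i)] [∀ i, Module S (M i)]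
    (h : ∀ i, PdLT S (M i) d) : PdLT S (∀ i, M i) d := by
  induction l with
  | zero => exact PdLT.of_subsingleton d
  | succ l ih =>
    have h1 : PdLT S (M 0 × ∀ i : Fin l, M i.succ) d := (h 0).prod (ih fun i => h i.succ)
    exact h1.of_equiv (Fin.consLinearEquiv S M).symm

end ProjDim

section Tensor

variable {𝕜 : Type u} [Field 𝕜] {S : Type u} [Ring S] [Algebra 𝕜 S]

/-- The functor `- ⊗ X` preserves short exact sequences of `S`-modules, so that `A ⊗ X` is a syzygy of
`C ⊗ X`. -/
lemma PdLT.right_tensor {A B C : Type u} [AddCommGroup A] [AddCommGroup B] [AddCommGroup C]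
    [Module 𝕜 A] [Module 𝕜 B] [Module 𝕜 C] [Module S A] [Module S B] [Module S C]
    [IsScalarTower 𝕜 S A] [IsScalarTower 𝕜 S B] [IsScalarTower 𝕜 S C]
    {f : A →ₗ[S] B} {g : B →ₗ[S] C} (hf : Function.Injective f) (hfg : Function.Exact f g)
    (hg : Function.Surjective g) (X : Type u) [AddCommGroup X] [Module 𝕜 X] {d : ℕ}
    (hA : PdLT S (A ⊗[𝕜] X) d) [Module.Projective S B] : PdLT S (C ⊗[𝕜] X) (d + 1) := by
  have hP : Module.Projective S (B ⊗[𝕜] X) := inferInstance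
  let F : A ⊗[𝕜] X →ₗ[S] B ⊗[𝕜] X := AlgebraTensorModule.map f (LinearMap.id : X →ₗ[𝕜] X)
  let G : B ⊗[𝕜] X →ₗ[S] C ⊗[𝕜] X := AlgebraTensorModule.map g (LinearMap.id : X →ₗ[𝕜] X)
  have hF : Function.Injective F :=
    Module.Flat.rTensor_preserves_injective_linearMap (M := X) (f.restrictScalars 𝕜) hf
  have hFG : Function.Exact F G :=
    rTensor_exact X (f := f.restrictScalars 𝕜) (g := g.restrictScalars 𝕜) hfg hg
  have hG : Function.Surjective G :=
    LinearMap.rTensor_surjective X (g := g.restrictScalars 𝕜) hg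
  exact PdLT.right hF hFG hG hA hP

/-- Tensoring with a vector space does not increase the projective dimension. -/
lemma PdLT.tensor (X : Type u) [AddCommGroup X] [Module 𝕜 X] {d : ℕ} :
    ∀ {A : Type u} [AddCommGroup A] [Module 𝕜 A] [Module S A] [IsScalarTower 𝕜 S A],
      PdLT S A d → PdLT S (A ⊗[𝕜] X) d := by
  induction d with
  | zero =>
    intro A _ _ _ _ h
    have := pdLT_zero_iff.1 h
    have h2 : ∀ t : A ⊗[𝕜] X, t = 0 := fun t => by
      induction t with
      | zero => rfl
      | tmul a x => rw [Subsingleton.elim a 0, zero_tmul]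
      | add a b ha hb => rw [ha, hb, add_zero]
    exact pdLT_zero_iff.2 ⟨fun a b => by rw [h2 a, h2 b]⟩
  | succ d ih =>
    intro A _ _ _ _ h
    cases d with
    | zero =>
      have := pdLT_one_iff.1 h
      exact pdLT_one_iff.2 inferInstance
    | succ d =>
      let g : (A →₀ S) →ₗ[S] A := Finsupp.linearCombination S id
      have hg : Function.Surjective g := Finsupp.linearCombination_id_surjective S A
      have hK : PdLT S (LinearMap.ker g) (d + 1) :=
        PdLT.left (f := (LinearMap.ker g).subtype) (g := g) Subtype.val_injective
          (LinearMap.exact_subtype_ker_map g) hg h inferInstance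
      exact PdLT.right_tensor (f := (LinearMap.ker g).subtype) (g := g) Subtype.val_injective
        (LinearMap.exact_subtype_ker_map g) hg X (ih hK)

end Tensor

/-! ### Calculus with the generators in a right module -/

section Smul

variable {𝕜 : Type u} [Field 𝕜] {n m : ℕ} {V W : Fin m → Submodule 𝕜 (Fin n → 𝕜)}
variable {M : Type*} [AddCommGroup M] [Module (FamilyOp V W) M]

lemma famE_two_smul (x : M) : famE V W .two • x = x - famE V W .one • x := by
  rw [eq_sub_iff_add_eq', ← add_smul, famE_add, one_smul]

lemma famE_one_famE_one_smul (x : M) :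
    famE V W .one • famE V W .one • x = famE V W .one • x := by
  have h := famE_two_smul (V := V) (W := W) (famE V W .one • x)
  rw [smul_smul, famE_two_mul_one, zero_smul] at h
  exact (sub_eq_zero.1 h.symm).symm

lemma famE_one_famB_smul (i : Fin m) (x : M) : famE V W .one • famB V W i • x = 0 := by
  rw [← famE_two_mul_famB, mul_smul, smul_smul, famE_one_mul_two, zero_smul]

lemma famE_one_famC_smul (y : Fin n → 𝕜) (x : M) :
    famE V W .one • famC V W y • x = famC V W y • x := by
  rw [smul_smul, famE_one_mul_famC]

lemma famB_famE_one_smul (i : Fin m) (x : M) : famB V W i • famE V W .one • x = famB V W i • x := by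
  rw [smul_smul, famB_mul_famE_one]

lemma famC_famE_one_smul (y : Fin n → 𝕜) (x : M) : famC V W y • famE V W .one • x = 0 := by
  rw [← famC_mul_famE_two, mul_smul, smul_smul (famE V W .two), famE_two_mul_one, zero_smul,
    smul_zero]

lemma famB_famB_smul (i j : Fin m) (x : M) : famB V W j • famB V W i • x = 0 := by
  rw [← famB_famE_one_smul, famE_one_famB_smul, smul_zero]

lemma famC_famC_smul (y z : Fin n → 𝕜) (x : M) : famC V W z • famC V W y • x = 0 := by
  rw [← famE_one_famC_smul y, famC_famE_one_smul]

lemma famB_famC_famB_smul (i j : Fin m) (y : Fin n → 𝕜) (x : M) :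
    famB V W j • famC V W y • famB V W i • x = 0 := by
  rw [smul_smul, smul_smul, famB_mul_famC_mul_famB, zero_smul]

lemma famE_one_famE_two_smul (x : M) : famE V W .one • famE V W .two • x = 0 := by
  rw [smul_smul, famE_one_mul_two, zero_smul]

lemma famE_two_famE_one_smul (x : M) : famE V W .two • famE V W .one • x = 0 := by
  rw [smul_smul, famE_two_mul_one, zero_smul]

lemma famE_two_famC_smul (y : Fin n → 𝕜) (x : M) : famE V W .two • famC V W y • x = 0 := by
  rw [famE_two_smul, famE_one_famC_smul, sub_self]

end Smul

section Linear

variable {𝕜 : Type u} [Field 𝕜] {n m : ℕ} {V W : Fin m → Submodule 𝕜 (Fin n → 𝕜)}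
variable {M N : Type u} [AddCommGroup M] [AddCommGroup N] [Module 𝕜 M] [Module 𝕜 N]
  [Module (FamilyOp V W) M] [Module (FamilyOp V W) N] [IsScalarTower 𝕜 (FamilyOp V W) M]
  [IsScalarTower 𝕜 (FamilyOp V W) N]

/-- A `𝕜`-linear map that commutes with the generators is a map of right `R_F`-modules. -/
def FamilyOp.linearMap (f : M →ₗ[𝕜] N) (he : ∀ x, f (famE V W .one • x) = famE V W .one • f x)
    (hb : ∀ i x, f (famB V W i • x) = famB V W i • f x)
    (hc : ∀ y x, f (famC V W y • x) = famC V W y • f x) : M →ₗ[FamilyOp V W] N where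
  toFun := f
  map_add' := map_add f
  map_smul' s := by
    induction s using FamilyOp.induction with
    | algebraMap a => intro x; rw [algebraMap_smul, map_smul, RingHom.id_apply, algebraMap_smul]
    | add s t hs ht => intro x; simp_all [add_smul]
    | mul s t hs ht => intro x; simp_all [mul_smul]
    | e q => intro x; cases q <;> simp [famE_two_smul, he]
    | b i => exact hb i
    | c y => exact hc y

/-- A subspace that is stable under the generators is a submodule. -/
def FamilyOp.submodule (p : Submodule 𝕜 M) (he : ∀ x ∈ p, famE V W .one • x ∈ p)
    (hb : ∀ i, ∀ x ∈ p, famB V W i • x ∈ p) (hc : ∀ y, ∀ x ∈ p, famC V W y • x ∈ p) :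
    Submodule (FamilyOp V W) M where
  carrier := p
  add_mem' := p.add_mem
  zero_mem' := p.zero_mem
  smul_mem' s := by
    induction s using FamilyOp.induction with
    | algebraMap a => intro x hx; rw [algebraMap_smul]; exact p.smul_mem a hx
    | add s t hs ht => intro x hx; rw [add_smul]; exact p.add_mem (hs hx) (ht hx)
    | mul s t hs ht => intro x hx; rw [mul_smul]; exact hs (ht hx)
    | e q =>
      intro x hx
      cases q
      · exact he x hx
      · rw [famE_two_smul]; exact p.sub_mem hx (he x hx)
    | b i => exact hb i _
    | c y => exact hc y _

end Linear

/-! ### The modules `b_j R_F` -/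

section BMod

variable {𝕜 : Type u} [Field 𝕜] {n m : ℕ} (V W : Fin m → Submodule 𝕜 (Fin n → 𝕜))

/-- The representation on `𝕜 × C/V_j` in which `C` maps `𝕜` to `C/V_j`. -/
def bRep (j : Fin m) : RightRep V W (𝕜 × ((Fin n → 𝕜) ⧸ V j)) where
  e
    | .one => LinearMap.inr 𝕜 _ _ ∘ₗ LinearMap.snd 𝕜 _ _
    | .two => LinearMap.inl 𝕜 _ _ ∘ₗ LinearMap.fst 𝕜 _ _
  b _ := 0
  c := LinearMap.mk₂ 𝕜 (fun y x => (0, x.1 • (V j).mkQ y))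
    (by intros; ext <;> simp)
    (fun a y x => Prod.ext (by simp) (by simpa using smul_comm x.1 a _))
    (by intros; ext <;> simp [add_smul]) (by intros; ext <;> simp [mul_smul])
  e_add x := by simp
  e_two_e_one x := by simp
  e_one_e_two x := by simp
  c_e_two y x := by simp
  e_one_c y x := by simp
  b_e_one i x := by simp
  e_two_b i x := by simp
  b_c_b i j y x := by simp
  w_b i y hy x := by simp
  b_v i y hy x := by simp

/-- The right module `b_j R_F`, with underlying vector space `𝕜 b_j ⊕ b_j C ≅ 𝕜 × C/V_j`. -/
abbrev BMod (j : Fin m) : Type u := (bRep V W j).Carrier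

/-- The generator `b_j` of `b_j R_F`. -/
def bTop (j : Fin m) : BMod V W j := ((1, 0) : 𝕜 × ((Fin n → 𝕜) ⧸ V j))

variable {V W}

lemma famE_smul_bTop (j : Fin m) : famE V W .one • bTop V W j = 0 := by
  rw [RightRep.famE_smul]; simp [bRep, bTop]; rfl

lemma famB_smul_bMod (i j : Fin m) (x : BMod V W j) : famB V W i • x = 0 := by
  rw [RightRep.famB_smul]; rfl

lemma famC_smul_bTop (j : Fin m) (y : Fin n → 𝕜) :
    famC V W y • bTop V W j = ((0, (V j).mkQ y) : 𝕜 × ((Fin n → 𝕜) ⧸ V j)) := by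
  rw [RightRep.famC_smul]
  exact Prod.ext rfl (one_smul 𝕜 _)

lemma famC_smul_bTop_eq_zero {j : Fin m} {y : Fin n → 𝕜} (hy : y ∈ V j) :
    famC V W y • bTop V W j = 0 := by
  rw [famC_smul_bTop]
  exact Prod.ext rfl ((Submodule.Quotient.mk_eq_zero _).2 hy)

lemma exists_eq_bTop {j : Fin m} (x : BMod V W j) :
    ∃ (a : 𝕜) (y : Fin n → 𝕜), x = a • bTop V W j + famC V W y • bTop V W j := by
  obtain ⟨a, d⟩ := x
  obtain ⟨y, rfl⟩ := (V j).mkQ_surjective d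
  refine ⟨a, y, ?_⟩
  rw [famC_smul_bTop]
  change _ = ((a • ((1 : 𝕜), (0 : (Fin n → 𝕜) ⧸ V j))) + ((0 : 𝕜), (V j).mkQ y) : 𝕜 × _)
  simp

lemma bMod_hom_ext {j : Fin m} {N : Type*} [AddCommGroup N] [Module (FamilyOp V W) N]
    {f g : BMod V W j →ₗ[FamilyOp V W] N} (h : f (bTop V W j) = g (bTop V W j)) (x : BMod V W j) :
    f x = g x := by
  obtain ⟨a, y, rfl⟩ := exists_eq_bTop x
  rw [← algebraMap_smul (FamilyOp V W) a, map_add, map_add, map_smul, map_smul, map_smul, map_smul,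
    h]

variable (V W)

lemma le_ker_mulRight_famB (j : Fin m) :
    V j ≤ LinearMap.ker (LinearMap.mulRight 𝕜 (famB V W j) ∘ₗ famC V W) :=
  fun _ hy => famC_mul_famB hy

/-- The inclusion of `b_j R_F` into `R_F`, as a linear map. -/
def bModInclₗ (j : Fin m) : BMod V W j →ₗ[𝕜] FamilyOp V W :=
  ((LinearMap.toSpanSingleton 𝕜 (FamilyOp V W) (famB V W j)).coprod
    ((V j).liftQ _ (le_ker_mulRight_famB V W j)) : 𝕜 × ((Fin n → 𝕜) ⧸ V j) →ₗ[𝕜] FamilyOp V W)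

lemma bModInclₗ_bTop (j : Fin m) : bModInclₗ V W j (bTop V W j) = famB V W j := by
  change (1 : 𝕜) • famB V W j + (V j).liftQ _ (le_ker_mulRight_famB V W j) 0 = _
  rw [one_smul, map_zero, add_zero]

lemma bModInclₗ_famC_bTop (j : Fin m) (y : Fin n → 𝕜) :
    bModInclₗ V W j (famC V W y • bTop V W j) = famC V W y • famB V W j := by
  rw [famC_smul_bTop]
  change (0 : 𝕜) • famB V W j + (V j).liftQ _ (le_ker_mulRight_famB V W j) ((V j).mkQ y) = _
  rw [zero_smul, zero_add, Submodule.mkQ_apply, Submodule.liftQ_apply]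
  rfl

/-- The inclusion of `b_j R_F` into `R_F`. -/
noncomputable def bModIncl (j : Fin m) : BMod V W j →ₗ[FamilyOp V W] FamilyOp V W :=
  FamilyOp.linearMap (bModInclₗ V W j)
    (by
      intro x
      obtain ⟨a, y, rfl⟩ := exists_eq_bTop x
      have h := famE_one_famB_smul (V := V) (W := W) j (1 : FamilyOp V W)
      rw [smul_eq_mul, smul_eq_mul, mul_one] at h
      simp only [smul_add, smul_comm _ a, map_add, map_smul, famE_smul_bTop, famE_one_famC_smul,
        bModInclₗ_famC_bTop, bModInclₗ_bTop, map_zero]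
      rw [smul_eq_mul (famE V W _), h])
    (by
      intro i x
      obtain ⟨a, y, rfl⟩ := exists_eq_bTop x
      have h := famB_famB_smul (V := V) (W := W) j i (1 : FamilyOp V W)
      have h2 := famB_famC_famB_smul (V := V) (W := W) j i y (1 : FamilyOp V W)
      simp only [smul_eq_mul, mul_one] at h h2
      simp only [smul_add, smul_comm _ a, map_add, map_smul, famB_smul_bMod,
        bModInclₗ_famC_bTop, bModInclₗ_bTop, map_zero]
      simp only [smul_eq_mul, h, h2, smul_zero, add_zero])
    (by
      intro z x
      obtain ⟨a, y, rfl⟩ := exists_eq_bTop x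
      simp only [smul_add, smul_comm _ a, map_add, map_smul, famC_famC_smul,
        bModInclₗ_famC_bTop, bModInclₗ_bTop, map_zero])

lemma bModIncl_bTop (j : Fin m) : bModIncl V W j (bTop V W j) = famB V W j :=
  bModInclₗ_bTop V W j

end BMod

/-! ### Modules built from linear maps -/

section GMod

variable {𝕜 : Type u} [Field 𝕜] {n m : ℕ} {V W : Fin m → Submodule 𝕜 (Fin n → 𝕜)}
variable {Y T : Type u} {X : Fin m → Type u} [AddCommGroup Y] [AddCommGroup T]
  [∀ j, AddCommGroup (X j)] [Module 𝕜 Y] [Module 𝕜 T] [∀ j, Module 𝕜 (X j)]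

variable (V W X) in
/-- The module `∏ j, b_j R_F ⊗ X_j`. -/
abbrev BTensor : Type u := ∀ j, BMod V W j ⊗[𝕜] X j

variable (V W) in
/-- The linear map `x ↦ b_j ⊗ x`. -/
noncomputable def bSingle (j : Fin m) : X j →ₗ[𝕜] BTensor V W X :=
  LinearMap.single 𝕜 (fun j => BMod V W j ⊗[𝕜] X j) j ∘ₗ TensorProduct.mk 𝕜 _ _ (bTop V W j)

lemma smul_bSingle (s : FamilyOp V W) (j : Fin m) (x : X j) :
    s • bSingle V W j x = Pi.single j ((s • bTop V W j) ⊗ₜ[𝕜] x) := by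
  rw [← smul_tmul', Pi.single_smul]
  rfl

lemma famE_smul_bSingle (j : Fin m) (x : X j) : famE V W .one • bSingle V W j x = 0 := by
  rw [smul_bSingle, famE_smul_bTop, zero_tmul, Pi.single_zero]

lemma famC_smul_bSingle {j : Fin m} {y : Fin n → 𝕜} (hy : y ∈ V j) (x : X j) :
    famC V W y • bSingle V W j x = 0 := by
  rw [smul_bSingle, famC_smul_bTop_eq_zero hy, zero_tmul, Pi.single_zero]

lemma famB_smul_bTensor (i : Fin m) (z : BTensor V W X) : famB V W i • z = 0 := by
  ext j
  rw [Pi.smul_apply, Pi.zero_apply]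
  induction z j with
  | zero => rw [smul_zero]
  | tmul b x => rw [smul_tmul', famB_smul_bMod, zero_tmul]
  | add z z' h h' => rw [smul_add, h, h', add_zero]

/-- The representation on `Y × T × ∏ j, b_j R_F ⊗ X_j` with `Y` at the vertex `2` and `T` at the
vertex `1`, in which `C` maps `Y` to `T` by `γ`, and `b_j` maps `t : T` to `b_j ⊗ π_j t`. -/
noncomputable def gRep (γ : (Fin n → 𝕜) →ₗ[𝕜] Y →ₗ[𝕜] T) (π : ∀ j, T →ₗ[𝕜] X j)
    (h : ∀ j, ∀ w ∈ W j, ∀ y, π j (γ w y) = 0) :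
    RightRep V W (Y × T × BTensor V W X) where
  e
    | .one => (0 : Module.End 𝕜 Y).prodMap (LinearMap.id.prodMap
        (Algebra.lsmul 𝕜 𝕜 _ (famE V W .one)))
    | .two => LinearMap.id.prodMap ((0 : Module.End 𝕜 T).prodMap
        (Algebra.lsmul 𝕜 𝕜 _ (famE V W .two)))
  b j := LinearMap.inr 𝕜 _ _ ∘ₗ LinearMap.inr 𝕜 _ _ ∘ₗ bSingle V W j ∘ₗ π j ∘ₗ
    LinearMap.fst 𝕜 _ _ ∘ₗ LinearMap.snd 𝕜 _ _
  c := LinearMap.mk₂ 𝕜 (fun y x => (0, γ y x.1, famC V W y • x.2.2))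
    (fun y z x => by simp [add_smul]) (fun a y x => by simp)
    (fun y x x' => by simp) (fun a y x => by simp [smul_comm _ a])
  e_add x := Prod.ext (zero_add _) (Prod.ext (add_zero _) (by
    change famE V W .one • x.2.2 + famE V W .two • x.2.2 = x.2.2
    rw [← add_smul, famE_add, one_smul]))
  e_two_e_one x := Prod.ext rfl (Prod.ext rfl (famE_one_famE_two_smul (V := V) (W := W) x.2.2))
  e_one_e_two x := Prod.ext rfl (Prod.ext rfl (famE_two_famE_one_smul (V := V) (W := W) x.2.2))
  c_e_two y x := Prod.ext rfl (Prod.ext rfl (famE_two_famC_smul (V := V) (W := W) y x.2.2))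
  e_one_c y x := Prod.ext rfl (Prod.ext (map_zero _) (famC_famE_one_smul (V := V) (W := W) y x.2.2))
  b_e_one i x := Prod.ext rfl (Prod.ext rfl (famE_smul_bSingle i _))
  e_two_b i x := Prod.ext rfl (Prod.ext rfl (by
    change bSingle V W i (π i 0) = 0
    rw [map_zero, map_zero]))
  b_c_b i j y x := Prod.ext rfl (Prod.ext rfl (by
    change bSingle V W j (π j (γ y 0)) = 0
    rw [map_zero, map_zero, map_zero]))
  w_b i y hy x := Prod.ext rfl (Prod.ext rfl (by
    change bSingle V W i (π i (γ y x.1)) = 0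
    rw [h i y hy, map_zero]))
  b_v i y hy x := Prod.ext rfl (Prod.ext (map_zero _) (famC_smul_bSingle hy _))

variable (γ : (Fin n → 𝕜) →ₗ[𝕜] Y →ₗ[𝕜] T) (π : ∀ j, T →ₗ[𝕜] X j)
    (h : ∀ j, ∀ w ∈ W j, ∀ y, π j (γ w y) = 0)

variable (V) in
/-- The module of the representation `gRep`. -/
def GMod : Type u := (gRep (V := V) (W := W) γ π h).Carrier

noncomputable instance : AddCommGroup (GMod V γ π h) := (gRep γ π h).instAddCommGroup
noncomputable instance : Module 𝕜 (GMod V γ π h) := (gRep γ π h).instModule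
noncomputable instance : Module (FamilyOp V W) (GMod V γ π h) := (gRep γ π h).instModuleOp
instance : IsScalarTower 𝕜 (FamilyOp V W) (GMod V γ π h) := (gRep γ π h).instIsScalarTower

variable {γ π h}

variable (γ π h) in
/-- The underlying vector space of `GMod`. -/
noncomputable def gEquiv : (Y × T × BTensor V W X) ≃ₗ[𝕜] GMod V γ π h := LinearEquiv.refl 𝕜 _

/-- The element of `GMod` with given components. -/
def gMk (y : Y) (t : T) (z : BTensor V W X) : GMod V γ π h := (y, t, z)

lemma exists_eq_gMk (x : GMod V γ π h) : ∃ y t z, x = gMk y t z := ⟨x.1, x.2.1, x.2.2, rfl⟩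

lemma gMk_inj {y y' : Y} {t t' : T} {z z' : BTensor V W X} :
    (gMk y t z : GMod V γ π h) = gMk y' t' z' ↔ y = y' ∧ t = t' ∧ z = z' := by
  refine Iff.trans Prod.mk_inj (and_congr_right fun _ => Prod.mk_inj)

lemma gMk_add (y y' : Y) (t t' : T) (z z' : BTensor V W X) :
    (gMk (y + y') (t + t') (z + z') : GMod V γ π h) = gMk y t z + gMk y' t' z' := rfl

lemma gMk_smul (a : 𝕜) (y : Y) (t : T) (z : BTensor V W X) :
    (gMk (a • y) (a • t) (a • z) : GMod V γ π h) = a • gMk y t z := rfl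

lemma gMk_zero : (gMk 0 0 0 : GMod V γ π h) = 0 := rfl

lemma famE_smul_gMk (y : Y) (t : T) (z : BTensor V W X) :
    famE V W .one • (gMk y t z : GMod V γ π h) = gMk 0 t (famE V W .one • z) :=
  (gRep γ π h).famE_smul .one (gMk y t z)

lemma famB_smul_gMk (j : Fin m) (y : Y) (t : T) (z : BTensor V W X) :
    famB V W j • (gMk y t z : GMod V γ π h) = gMk 0 0 (bSingle V W j (π j t)) :=
  (gRep γ π h).famB_smul j (gMk y t z)

lemma famC_smul_gMk (c : Fin n → 𝕜) (y : Y) (t : T) (z : BTensor V W X) :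
    famC V W c • (gMk y t z : GMod V γ π h) = gMk 0 (γ c y) (famC V W c • z) :=
  (gRep γ π h).famC_smul c (gMk y t z)

variable (γ π h) in
/-- The inclusion of the submodule `∏ j, b_j R_F ⊗ X_j`. -/
noncomputable def gIncl : BTensor V W X →ₗ[FamilyOp V W] GMod V γ π h :=
  FamilyOp.linearMap
    ((gEquiv γ π h).toLinearMap ∘ₗ LinearMap.inr 𝕜 Y (T × BTensor V W X) ∘ₗ
      LinearMap.inr 𝕜 T (BTensor V W X))
    (fun z => (famE_smul_gMk 0 0 z).symm)
    (fun i z => by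
      rw [famB_smul_bTensor, map_zero]
      refine Eq.trans ?_ (famB_smul_gMk i 0 0 z).symm
      rw [map_zero, map_zero, gMk_zero])
    (fun c z => by
      refine Eq.trans ?_ (famC_smul_gMk c 0 0 z).symm
      rw [map_zero]
      rfl)

lemma gIncl_apply (z : BTensor V W X) : gIncl γ π h z = gMk 0 0 z := rfl

section Lift

variable {N : Type u} [AddCommGroup N] [Module 𝕜 N] [Module (FamilyOp V W) N]
  [IsScalarTower 𝕜 (FamilyOp V W) N]

/-- A linear map out of `GMod`, given by its values on the components. -/
noncomputable def gLift (fY : Y →ₗ[𝕜] N) (fT : T →ₗ[𝕜] N)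
    (fX : BTensor V W X →ₗ[FamilyOp V W] N) (hY : ∀ y, famE V W .one • fY y = 0)
    (hT : ∀ t, famE V W .one • fT t = fT t) (hC : ∀ c y, famC V W c • fY y = fT (γ c y))
    (hB : ∀ j t, famB V W j • fT t = fX (bSingle V W j (π j t))) :
    GMod V γ π h →ₗ[FamilyOp V W] N :=
  have hB0 (j : Fin m) (z : BTensor V W X) : famB V W j • fX z = 0 := by
    rw [← map_smul, famB_smul_bTensor, map_zero]
  FamilyOp.linearMap (fY.coprod (fT.coprod (fX.restrictScalars 𝕜)) ∘ₗ
      (gEquiv γ π h).symm.toLinearMap)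
    (by
      intro x
      obtain ⟨y, t, z, rfl⟩ := exists_eq_gMk x
      rw [famE_smul_gMk]
      change fY 0 + (fT t + fX (famE V W .one • z)) = famE V W .one • (fY y + (fT t + fX z))
      rw [smul_add, smul_add, hY, hT, map_zero, map_smul])
    (by
      intro i x
      obtain ⟨y, t, z, rfl⟩ := exists_eq_gMk x
      rw [famB_smul_gMk]
      change fY 0 + (fT 0 + fX (bSingle V W i (π i t))) = famB V W i • (fY y + (fT t + fX z))
      rw [smul_add, smul_add, hB, hB0, map_zero, map_zero, ← famB_famE_one_smul, hY, smul_zero]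
      abel)
    (by
      intro c x
      obtain ⟨y, t, z, rfl⟩ := exists_eq_gMk x
      rw [famC_smul_gMk]
      change fY 0 + (fT (γ c y) + fX (famC V W c • z)) = famC V W c • (fY y + (fT t + fX z))
      rw [smul_add, smul_add, hC, ← hT t, famC_famE_one_smul, map_zero, map_smul]
      abel)

lemma gLift_gMk (fY : Y →ₗ[𝕜] N) (fT : T →ₗ[𝕜] N)
    (fX : BTensor V W X →ₗ[FamilyOp V W] N) (hY hT hC hB) (y : Y) (t : T) (z : BTensor V W X) :
    gLift (γ := γ) (π := π) (h := h) fY fT fX hY hT hC hB (gMk y t z) = fY y + (fT t + fX z) := rfl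

end Lift

section Map

variable {Y' T' : Type u} {X' : Fin m → Type u} [AddCommGroup Y'] [AddCommGroup T']
  [∀ j, AddCommGroup (X' j)] [Module 𝕜 Y'] [Module 𝕜 T'] [∀ j, Module 𝕜 (X' j)]
  {γ' : (Fin n → 𝕜) →ₗ[𝕜] Y' →ₗ[𝕜] T'} {π' : ∀ j, T' →ₗ[𝕜] X' j}
  {h' : ∀ j, ∀ w ∈ W j, ∀ y, π' j (γ' w y) = 0}

/-- The map induced on `∏ j, b_j R_F ⊗ X_j` by linear maps of the spaces `X_j`. -/
noncomputable def bTensorMap (fX : ∀ j, X j →ₗ[𝕜] X' j) :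
    BTensor V W X →ₗ[FamilyOp V W] BTensor V W X' :=
  LinearMap.piMap fun j => AlgebraTensorModule.map LinearMap.id (fX j)

lemma bTensorMap_bSingle (fX : ∀ j, X j →ₗ[𝕜] X' j) (j : Fin m) (x : X j) :
    bTensorMap fX (bSingle V W j x) = bSingle V W j (fX j x) := by
  ext i
  by_cases hi : i = j
  · subst hi
    simp [bTensorMap, bSingle]
  · simp [bTensorMap, bSingle, Pi.single_eq_of_ne hi]

/-- The map of modules `GMod` induced by linear maps of the components. -/
noncomputable def gMap (fY : Y →ₗ[𝕜] Y') (fT : T →ₗ[𝕜] T') (fX : ∀ j, X j →ₗ[𝕜] X' j)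
    (hC : ∀ c y, γ' c (fY y) = fT (γ c y)) (hB : ∀ j t, π' j (fT t) = fX j (π j t)) :
    GMod V γ π h →ₗ[FamilyOp V W] GMod V γ' π' h' :=
  FamilyOp.linearMap ((gEquiv γ' π' h').toLinearMap ∘ₗ
      fY.prodMap (fT.prodMap ((bTensorMap fX).restrictScalars 𝕜)) ∘ₗ
      (gEquiv γ π h).symm.toLinearMap)
    (by
      intro x
      obtain ⟨y, t, z, rfl⟩ := exists_eq_gMk x
      rw [famE_smul_gMk]
      refine Eq.trans ?_ (famE_smul_gMk (fY y) (fT t) (bTensorMap fX z)).symm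
      change gMk (fY 0) (fT t) (bTensorMap fX (famE V W .one • z)) = _
      rw [map_smul, map_zero])
    (by
      intro i x
      obtain ⟨y, t, z, rfl⟩ := exists_eq_gMk x
      rw [famB_smul_gMk]
      refine Eq.trans ?_ (famB_smul_gMk i (fY y) (fT t) (bTensorMap fX z)).symm
      change gMk (fY 0) (fT 0) (bTensorMap fX (bSingle V W i (π i t))) = _
      rw [hB, bTensorMap_bSingle, map_zero, map_zero])
    (by
      intro c x
      obtain ⟨y, t, z, rfl⟩ := exists_eq_gMk x
      rw [famC_smul_gMk]
      refine Eq.trans ?_ (famC_smul_gMk c (fY y) (fT t) (bTensorMap fX z)).symm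
      change gMk (fY 0) (fT (γ c y)) (bTensorMap fX (famC V W c • z)) = _
      rw [hC, map_smul, map_zero])

lemma gMap_gMk (fY : Y →ₗ[𝕜] Y') (fT : T →ₗ[𝕜] T') (fX : ∀ j, X j →ₗ[𝕜] X' j) (hC hB)
    (y : Y) (t : T) (z : BTensor V W X) :
    gMap (γ := γ) (π := π) (h := h) (γ' := γ') (π' := π') (h' := h') fY fT fX hC hB (gMk y t z) =
      gMk (fY y) (fT t) (bTensorMap fX z) := rfl

end Map

end GMod

/-! ### Exact sequences -/

section Exactness

variable {𝕜 : Type u} [Field 𝕜] {n m : ℕ} {V W : Fin m → Submodule 𝕜 (Fin n → 𝕜)}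
variable {Y T : Type u} {X : Fin m → Type u} [AddCommGroup Y] [AddCommGroup T]
  [∀ j, AddCommGroup (X j)] [Module 𝕜 Y] [Module 𝕜 T] [∀ j, Module 𝕜 (X j)]
  {γ : (Fin n → 𝕜) →ₗ[𝕜] Y →ₗ[𝕜] T} {π : ∀ j, T →ₗ[𝕜] X j}
  {h : ∀ j, ∀ w ∈ W j, ∀ y, π j (γ w y) = 0}
variable {Y' T' : Type u} {X' : Fin m → Type u} [AddCommGroup Y'] [AddCommGroup T']
  [∀ j, AddCommGroup (X' j)] [Module 𝕜 Y'] [Module 𝕜 T'] [∀ j, Module 𝕜 (X' j)]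
  {γ' : (Fin n → 𝕜) →ₗ[𝕜] Y' →ₗ[𝕜] T'} {π' : ∀ j, T' →ₗ[𝕜] X' j}
  {h' : ∀ j, ∀ w ∈ W j, ∀ y, π' j (γ' w y) = 0}
variable {X'' : Fin m → Type u} [∀ j, AddCommGroup (X'' j)] [∀ j, Module 𝕜 (X'' j)]

lemma exists_smul_bTop {j : Fin m} (x : BMod V W j) : ∃ s : FamilyOp V W, x = s • bTop V W j := by
  obtain ⟨a, y, rfl⟩ := exists_eq_bTop x
  exact ⟨algebraMap 𝕜 _ a + famC V W y, by rw [add_smul, algebraMap_smul]⟩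

lemma bTensor_hom_ext {N : Type*} [AddCommGroup N] [Module (FamilyOp V W) N]
    {f g : BTensor V W X →ₗ[FamilyOp V W] N}
    (hfg : ∀ j x, f (bSingle V W j x) = g (bSingle V W j x)) : f = g := by
  refine LinearMap.pi_ext fun j z => ?_
  induction z with
  | zero => rw [Pi.single_zero, map_zero, map_zero]
  | tmul b x =>
    obtain ⟨s, rfl⟩ := exists_smul_bTop b
    rw [← smul_bSingle, map_smul, map_smul, hfg]
  | add z z' hz hz' => rw [Pi.single_add, map_add, map_add, hz, hz']

lemma gMod_hom_ext {N : Type*} [AddCommGroup N] [Module (FamilyOp V W) N]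
    {f g : GMod V γ π h →ₗ[FamilyOp V W] N} (hY : ∀ y, f (gMk y 0 0) = g (gMk y 0 0))
    (hT : ∀ t, f (gMk 0 t 0) = g (gMk 0 t 0))
    (hX : ∀ j x, f (gMk 0 0 (bSingle V W j x)) = g (gMk 0 0 (bSingle V W j x))) : f = g := by
  ext x
  obtain ⟨y, t, z, rfl⟩ := exists_eq_gMk x
  have h1 : (gMk y t z : GMod V γ π h) = gMk y 0 0 + gMk 0 t 0 + gIncl γ π h z := by
    rw [gIncl_apply, ← gMk_add, ← gMk_add]
    simp only [add_zero, zero_add]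
  have h2 : f ∘ₗ gIncl γ π h = g ∘ₗ gIncl γ π h := bTensor_hom_ext hX
  rw [h1, map_add, map_add, map_add, map_add, hY, hT]
  exact congrArg _ (LinearMap.congr_fun h2 z)

lemma bTensorMap_injective {fX : ∀ j, X j →ₗ[𝕜] X' j} (hX : ∀ j, Function.Injective (fX j)) :
    Function.Injective (bTensorMap (V := V) (W := W) fX) :=
  Function.Injective.piMap fun j =>
    Module.Flat.lTensor_preserves_injective_linearMap (M := BMod V W j) (fX j) (hX j)

lemma bTensorMap_surjective {fX : ∀ j, X j →ₗ[𝕜] X' j} (hX : ∀ j, Function.Surjective (fX j)) :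
    Function.Surjective (bTensorMap (V := V) (W := W) fX) :=
  Function.Surjective.piMap fun j => LinearMap.lTensor_surjective (BMod V W j) (hX j)

lemma bTensorMap_exact {fX : ∀ j, X j →ₗ[𝕜] X' j} {gX : ∀ j, X' j →ₗ[𝕜] X'' j}
    (hX : ∀ j, Function.Exact (fX j) (gX j)) (hg : ∀ j, Function.Surjective (gX j)) :
    Function.Exact (bTensorMap (V := V) (W := W) fX) (bTensorMap (V := V) (W := W) gX) := by
  intro z
  have h1 (j : Fin m) : Function.Exact ((fX j).lTensor (BMod V W j)) ((gX j).lTensor _) :=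
    lTensor_exact (BMod V W j) (hX j) (hg j)
  constructor
  · intro hz
    choose x hx using fun j => (h1 j (z j)).1 (congrFun hz j)
    exact ⟨x, funext hx⟩
  · rintro ⟨x, rfl⟩
    funext j
    exact (h1 j _).2 ⟨x j, rfl⟩

lemma gMap_injective {fY : Y →ₗ[𝕜] Y'} {fT : T →ₗ[𝕜] T'} {fX : ∀ j, X j →ₗ[𝕜] X' j} {hC hB}
    (hY : Function.Injective fY) (hT : Function.Injective fT)
    (hX : ∀ j, Function.Injective (fX j)) :
    Function.Injective
      (gMap (V := V) (γ := γ) (π := π) (h := h) (γ' := γ') (π' := π') (h' := h')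
        fY fT fX hC hB) := by
  intro x x' hx
  obtain ⟨y, t, z, rfl⟩ := exists_eq_gMk x
  obtain ⟨y', t', z', rfl⟩ := exists_eq_gMk x'
  rw [gMap_gMk, gMap_gMk, gMk_inj] at hx
  rw [hY hx.1, hT hx.2.1, bTensorMap_injective hX hx.2.2]

lemma gMap_surjective {fY : Y →ₗ[𝕜] Y'} {fT : T →ₗ[𝕜] T'} {fX : ∀ j, X j →ₗ[𝕜] X' j} {hC hB}
    (hY : Function.Surjective fY) (hT : Function.Surjective fT)
    (hX : ∀ j, Function.Surjective (fX j)) :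
    Function.Surjective
      (gMap (V := V) (γ := γ) (π := π) (h := h) (γ' := γ') (π' := π') (h' := h')
        fY fT fX hC hB) := by
  intro x
  obtain ⟨y, t, z, rfl⟩ := exists_eq_gMk x
  obtain ⟨y, rfl⟩ := hY y
  obtain ⟨t, rfl⟩ := hT t
  obtain ⟨z, rfl⟩ := bTensorMap_surjective hX z
  exact ⟨gMk y t z, gMap_gMk ..⟩

end Exactness

section Modules

variable {𝕜 : Type u} [Field 𝕜] {n m : ℕ} {V W : Fin m → Submodule 𝕜 (Fin n → 𝕜)}
variable {T : Type u} {X : Fin m → Type u} [AddCommGroup T]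
  [∀ j, AddCommGroup (X j)] [Module 𝕜 T] [∀ j, Module 𝕜 (X j)]

variable (V W) in
/-- The module `T × ∏ j, b_j R_F ⊗ X_j` with `T` at the vertex `1`, in which `b_j` maps `t : T` to
`b_j ⊗ π_j t`. -/
abbrev StarMod (π : ∀ j, T →ₗ[𝕜] X j) : Type u :=
  GMod (W := W) (Y := PUnit.{u + 1}) V 0 π fun j _ _ _ => map_zero (π j)

variable (V W T) in
/-- The sum of copies of the projective module `e_1 R_F` indexed by a basis of `T`. -/
abbrev ProjOne : Type u := StarMod V W fun _ : Fin m => (LinearMap.id : T →ₗ[𝕜] T)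

variable (V W) in
/-- The projective module `e_2 R_F`. -/
abbrev ProjTwo : Type u :=
  GMod (W := W) V (LinearMap.lsmul 𝕜 (Fin n → 𝕜)).flip (fun j => (W j).mkQ) fun j w hw a => by
    rw [LinearMap.flip_apply, LinearMap.lsmul_apply, map_smul, Submodule.mkQ_apply,
      (Submodule.Quotient.mk_eq_zero _).2 hw, smul_zero]

variable (V W) in
/-- The simple module at the vertex `2`. -/
abbrev SimpleTwo : Type u :=
  GMod (W := W) (Y := 𝕜) (T := PUnit.{u + 1}) (X := fun _ : Fin m => PUnit.{u + 1}) V 0 0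
    fun _ _ _ _ => rfl

lemma famE_one_mul_famE_one : famE V W .one * famE V W .one = famE V W .one := by
  simpa only [smul_eq_mul, mul_one] using
    famE_one_famE_one_smul (V := V) (W := W) (1 : FamilyOp V W)

lemma sum_comp_proj_bSingle {N : Type*} [AddCommGroup N] [Module (FamilyOp V W) N]
    (f : ∀ j, BMod V W j ⊗[𝕜] X j →ₗ[FamilyOp V W] N) (j : Fin m) (x : X j) :
    (∑ i, f i ∘ₗ LinearMap.proj i : BTensor V W X →ₗ[FamilyOp V W] N) (bSingle V W j x) =
      f j (bTop V W j ⊗ₜ x) := by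
  rw [LinearMap.sum_apply, Finset.sum_eq_single j]
  · simp [bSingle]
  · intro i _ hi
    simp [bSingle, Pi.single_eq_of_ne hi]
  · exact fun hj => (hj (Finset.mem_univ j)).elim

/-- The embedding of `e_1 R_F ⊗ T` into `R_F ⊗ T`. -/
noncomputable def projOneIncl : ProjOne V W T →ₗ[FamilyOp V W] FamilyOp V W ⊗[𝕜] T :=
  gLift 0 (TensorProduct.mk 𝕜 _ T (famE V W .one))
    (∑ j, AlgebraTensorModule.map (bModIncl V W j) LinearMap.id ∘ₗ LinearMap.proj j)
    (fun _ => smul_zero _)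
    (fun t => by
      rw [TensorProduct.mk_apply, smul_tmul', smul_eq_mul, famE_one_mul_famE_one])
    (fun _ _ => (smul_zero _).trans (map_zero _).symm)
    (fun j t => by
      rw [sum_comp_proj_bSingle, TensorProduct.mk_apply, smul_tmul', smul_eq_mul,
        famB_mul_famE_one, AlgebraTensorModule.map_tmul, bModIncl_bTop]
      rfl)

/-- The projection of `R_F ⊗ T` onto `e_1 R_F ⊗ T`. -/
noncomputable def projOneProj : FamilyOp V W ⊗[𝕜] T →ₗ[FamilyOp V W] ProjOne V W T :=
  AlgebraTensorModule.lift (LinearMap.toSpanSingleton (FamilyOp V W) (T →ₗ[𝕜] ProjOne V W T)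
    ((gEquiv _ _ _).toLinearMap ∘ₗ LinearMap.inr 𝕜 _ _ ∘ₗ LinearMap.inl 𝕜 _ _))

lemma projOneProj_tmul (s : FamilyOp V W) (t : T) :
    projOneProj (s ⊗ₜ[𝕜] t) = s • (gMk 0 t 0 : ProjOne V W T) := rfl

instance : Module.Projective (FamilyOp V W) (ProjOne V W T) := by
  refine Module.Projective.of_split projOneIncl projOneProj
    (gMod_hom_ext (fun _ => ?_) (fun t => ?_) fun j t => ?_)
  · change projOneProj (projOneIncl (0 : ProjOne V W T)) = 0
    rw [map_zero, map_zero]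
  · rw [LinearMap.comp_apply, projOneIncl, gLift_gMk, map_zero, map_zero, add_zero, zero_add,
      TensorProduct.mk_apply, projOneProj_tmul, famE_smul_gMk, smul_zero, LinearMap.id_apply]
  · rw [LinearMap.comp_apply, projOneIncl, gLift_gMk, map_zero, map_zero, zero_add, zero_add,
      sum_comp_proj_bSingle, AlgebraTensorModule.map_tmul, bModIncl_bTop, projOneProj_tmul,
      famB_smul_gMk]
    rfl

/-- The bilinear map `(c, b) ↦ c b` from `C × b_j R_F` to `R_F`. -/
noncomputable def arrowMul (j : Fin m) :
    (Fin n → 𝕜) →ₗ[𝕜] BMod V W j →ₗ[FamilyOp V W] FamilyOp V W :=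
  LinearMap.mk₂' 𝕜 (FamilyOp V W) (fun c b => bModIncl V W j b * famC V W c)
    (fun c c' b => by rw [map_add, mul_add]) (fun a c b => by rw [map_smul, mul_smul_comm])
    (fun c b b' => by rw [map_add, add_mul])
    (fun s c b => by rw [map_smul, smul_eq_mul, smul_eq_mul, mul_assoc])

lemma arrowMul_apply (j : Fin m) (c : Fin n → 𝕜) (b : BMod V W j) :
    arrowMul j c b = bModIncl V W j b * famC V W c := rfl

lemma le_ker_arrowMul (j : Fin m) : W j ≤ LinearMap.ker (arrowMul (V := V) (W := W) j) := by
  refine fun c hc => LinearMap.mem_ker.2 (LinearMap.ext fun b => bMod_hom_ext ?_ b)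
  rw [arrowMul_apply, bModIncl_bTop, famB_mul_famC hc, LinearMap.zero_apply]

/-- The multiplication `b_j R_F ⊗ C/W_j → R_F` that maps `b_j ⊗ c` to `c b_j`. -/
noncomputable def quotMul (j : Fin m) :
    BMod V W j ⊗[𝕜] ((Fin n → 𝕜) ⧸ W j) →ₗ[FamilyOp V W] FamilyOp V W :=
  AlgebraTensorModule.lift (LinearMap.flip ((W j).liftQ (arrowMul j) (le_ker_arrowMul j)))

lemma quotMul_tmul (j : Fin m) (b : BMod V W j) (c : Fin n → 𝕜) :
    quotMul j (b ⊗ₜ (W j).mkQ c) = bModIncl V W j b * famC V W c := rfl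

/-- The embedding of `e_2 R_F` into `R_F`. -/
noncomputable def projTwoIncl : ProjTwo V W →ₗ[FamilyOp V W] FamilyOp V W :=
  gLift (LinearMap.toSpanSingleton 𝕜 _ (famE V W .two)) (famC V W)
    (∑ j, quotMul j ∘ₗ LinearMap.proj j)
    (fun a => by
      rw [LinearMap.toSpanSingleton_apply, smul_eq_mul, mul_smul_comm, famE_one_mul_two, smul_zero])
    (famE_one_mul_famC ·)
    (fun c a => by
      rw [LinearMap.toSpanSingleton_apply, smul_eq_mul, mul_smul_comm, famC_mul_famE_two,
        LinearMap.flip_apply, LinearMap.lsmul_apply, map_smul])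
    (fun j c => by
      rw [sum_comp_proj_bSingle, quotMul_tmul, bModIncl_bTop, smul_eq_mul])

instance : Module.Projective (FamilyOp V W) (ProjTwo V W) := by
  refine Module.Projective.of_split projTwoIncl
    (LinearMap.toSpanSingleton _ _ (gMk 1 0 0 : ProjTwo V W))
    (gMod_hom_ext (fun a => ?_) (fun c => ?_) fun j x => ?_)
  · rw [LinearMap.comp_apply, projTwoIncl, gLift_gMk, map_zero, map_zero, add_zero, add_zero,
      LinearMap.toSpanSingleton_apply, LinearMap.toSpanSingleton_apply, smul_assoc,
      famE_two_smul, famE_smul_gMk, smul_zero, gMk_zero, sub_zero, ← gMk_smul, smul_zero,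
      smul_zero, smul_eq_mul, mul_one, LinearMap.id_apply]
  · rw [LinearMap.comp_apply, projTwoIncl, gLift_gMk, map_zero, map_zero, add_zero, zero_add,
      LinearMap.toSpanSingleton_apply, famC_smul_gMk, LinearMap.flip_apply, LinearMap.lsmul_apply,
      one_smul, smul_zero, LinearMap.id_apply]
  · obtain ⟨c, rfl⟩ := (W j).mkQ_surjective x
    rw [LinearMap.comp_apply, projTwoIncl, gLift_gMk, map_zero, map_zero, zero_add, zero_add,
      sum_comp_proj_bSingle, quotMul_tmul, bModIncl_bTop, LinearMap.toSpanSingleton_apply,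
      mul_smul, famC_smul_gMk, famB_smul_gMk, LinearMap.flip_apply, LinearMap.lsmul_apply,
      one_smul, LinearMap.id_apply]

/-- The projection of `∏ j, b_j R_F ⊗ X_j` onto `b_j R_F` given by a linear form on `X_j`. -/
noncomputable def bCoord (j : Fin m) (φ : X j →ₗ[𝕜] 𝕜) :
    BTensor V W X →ₗ[FamilyOp V W] BMod V W j :=
  (AlgebraTensorModule.rid 𝕜 (FamilyOp V W) (BMod V W j)).toLinearMap ∘ₗ
    AlgebraTensorModule.map LinearMap.id φ ∘ₗ LinearMap.proj j

variable (V W) in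
/-- The map `b ↦ b ⊗ x` from `b_j R_F` to `∏ j, b_j R_F ⊗ X_j`. -/
noncomputable def bInsert (j : Fin m) (x : X j) : BMod V W j →ₗ[FamilyOp V W] BTensor V W X :=
  LinearMap.single (FamilyOp V W) (fun j => BMod V W j ⊗[𝕜] X j) j ∘ₗ
    (AlgebraTensorModule.mk 𝕜 (FamilyOp V W) (BMod V W j) (X j)).flip x

lemma bCoord_bInsert (j : Fin m) (φ : X j →ₗ[𝕜] 𝕜) (x : X j) (hx : φ x = 1) (b : BMod V W j) :
    bCoord j φ (bInsert V W j x b) = b := by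
  simp [bCoord, bInsert, hx]

lemma bCoord_bSingle (j : Fin m) (φ : X j →ₗ[𝕜] 𝕜) (x : X j) :
    bCoord j φ (bSingle V W j x) = φ x • bTop V W j := by
  simp [bCoord, bSingle]

lemma bCoord_bSingle_of_ne {i j : Fin m} (hij : i ≠ j) (φ : X j →ₗ[𝕜] 𝕜) (x : X i) :
    bCoord j φ (bSingle V W i x) = 0 := by
  simp [bCoord, bSingle, Pi.single_eq_of_ne hij.symm]

/-- Only the indices `j` with `X_j ≠ 0` matter for the projective dimension of
`∏ j, b_j R_F ⊗ X_j`. -/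
lemma PdLT.bTensor {d : ℕ} (hX : ∀ j, Nontrivial (X j) → PdLT (FamilyOp V W) (BMod V W j) d) :
    PdLT (FamilyOp V W) (BTensor V W X) d := by
  refine PdLT.pi fun j => ?_
  rcases subsingleton_or_nontrivial (X j) with hj | hj
  · have : Subsingleton (BMod V W j ⊗[𝕜] X j) := inferInstance
    exact PdLT.of_subsingleton d
  · exact (hX j hj).tensor (X j)

/-- If `X_j ≠ 0`, then `b_j R_F` is a direct summand of `∏ j, b_j R_F ⊗ X_j`. -/
lemma PdLT.of_bTensor {d : ℕ} (hd : PdLT (FamilyOp V W) (BTensor V W X) d) {j : Fin m}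
    [Nontrivial (X j)] : PdLT (FamilyOp V W) (BMod V W j) d := by
  obtain ⟨x, hx⟩ := exists_ne (0 : X j)
  obtain ⟨φ, hφ⟩ := Module.Projective.exists_dual_eq_one 𝕜 hx
  exact hd.of_retract (bInsert V W j x) (bCoord j φ) (bCoord_bInsert j φ x hφ)

/-- If `π_j` is not surjective, then `b_j R_F` is a direct summand of `StarMod π`: the projection is
given by a linear form on `X_j` that vanishes on the range of `π_j`. -/
lemma PdLT.of_starMod {d : ℕ} {π : ∀ j, T →ₗ[𝕜] X j} (hd : PdLT (FamilyOp V W) (StarMod V W π) d)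
    {j : Fin m} (hj : ¬ Function.Surjective (π j)) : PdLT (FamilyOp V W) (BMod V W j) d := by
  obtain ⟨x, hx⟩ : ∃ x, x ∉ LinearMap.range (π j) := by simpa [Function.Surjective] using hj
  obtain ⟨φ, hφ, hφ0⟩ : ∃ φ : X j →ₗ[𝕜] 𝕜, φ x = 1 ∧ ∀ t, φ (π j t) = 0 := by
    obtain ⟨f, hf, hf0⟩ := Submodule.exists_le_ker_of_notMem hx
    refine ⟨(f x)⁻¹ • f, inv_mul_cancel₀ hf, fun t => ?_⟩
    rw [LinearMap.smul_apply, hf0 ⟨t, rfl⟩, smul_zero]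
  refine hd.of_retract (gIncl _ _ _ ∘ₗ bInsert V W j x)
    (gLift 0 0 (bCoord j φ) (fun _ => smul_zero _) (fun _ => smul_zero _) (fun _ _ => smul_zero _)
      fun i t => ?_) (fun b => ?_)
  · rw [LinearMap.zero_apply, smul_zero]
    by_cases hij : i = j
    · subst hij
      rw [bCoord_bSingle, hφ0, zero_smul]
    · rw [bCoord_bSingle_of_ne hij]
  · rw [LinearMap.comp_apply, gIncl_apply, gLift_gMk, bCoord_bInsert j φ x hφ]
    simp

end Modules

/-! ### Syzygies -/

section Syzygies

variable {𝕜 : Type u} [Field 𝕜] {n m : ℕ} {V W : Fin m → Submodule 𝕜 (Fin n → 𝕜)}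
variable {T : Type u} {X : Fin m → Type u} [AddCommGroup T]
  [∀ j, AddCommGroup (X j)] [Module 𝕜 T] [∀ j, Module 𝕜 (X j)] {π : ∀ j, T →ₗ[𝕜] X j}

lemma bTensorMap_id (z : BTensor V W X) : bTensorMap (fun _ => LinearMap.id) z = z := by
  have h : bTensorMap (V := V) (W := W) (X := X) (fun _ => LinearMap.id) = LinearMap.id :=
    bTensor_hom_ext fun j x => bTensorMap_bSingle _ j x
  rw [h, LinearMap.id_apply]

variable (V W π) in
/-- The projective cover of `StarMod π`, when the maps `π_j` are surjective. -/
noncomputable def starCover : ProjOne V W T →ₗ[FamilyOp V W] StarMod V W π :=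
  gMap LinearMap.id LinearMap.id π (fun _ _ => rfl) fun _ _ => rfl

variable (V W π) in
/-- The inclusion of the kernel of `starCover`. -/
noncomputable def starKernel :
    BTensor V W (fun j => LinearMap.ker (π j)) →ₗ[FamilyOp V W] ProjOne V W T :=
  gIncl _ _ _ ∘ₗ bTensorMap fun j => (LinearMap.ker (π j)).subtype

lemma starKernel_injective : Function.Injective (starKernel V W π) := by
  intro z z' hz
  exact bTensorMap_injective (fun j => Subtype.val_injective) (gMk_inj.1 hz).2.2

lemma starCover_surjective (hπ : ∀ j, Function.Surjective (π j)) :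
    Function.Surjective (starCover V W π) :=
  gMap_surjective Function.surjective_id Function.surjective_id hπ

lemma starKernel_exact (hπ : ∀ j, Function.Surjective (π j)) :
    Function.Exact (starKernel V W π) (starCover V W π) := by
  have hex := bTensorMap_exact (V := V) (W := W)
    (fun j => LinearMap.exact_subtype_ker_map (π j)) hπ
  intro x
  obtain ⟨y, t, z, rfl⟩ := exists_eq_gMk x
  rw [starCover, gMap_gMk, ← gMk_zero, gMk_inj]
  constructor
  · rintro ⟨-, ht, hz⟩
    obtain ⟨z', hz'⟩ := (hex z).1 hz
    exact ⟨z', gMk_inj.2 ⟨rfl, ht.symm, hz'⟩⟩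
  · rintro ⟨z', hz'⟩
    obtain ⟨-, ht, hz⟩ := gMk_inj.1 hz'
    exact ⟨rfl, ht.symm, (hex z).2 ⟨z', hz⟩⟩

lemma PdLT.starMod {d : ℕ} (hπ : ∀ j, Function.Surjective (π j))
    (hd : PdLT (FamilyOp V W) (BTensor V W fun j => LinearMap.ker (π j)) d) :
    PdLT (FamilyOp V W) (StarMod V W π) (d + 1) :=
  PdLT.right (f := starKernel V W π) (g := starCover V W π)
    starKernel_injective (starKernel_exact hπ) (starCover_surjective hπ) hd
    inferInstance

lemma PdLT.starMod_kernel {d : ℕ} (hπ : ∀ j, Function.Surjective (π j))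
    (hd : PdLT (FamilyOp V W) (StarMod V W π) (d + 2)) :
    PdLT (FamilyOp V W) (BTensor V W fun j => LinearMap.ker (π j)) (d + 1) :=
  PdLT.left (f := starKernel V W π) (g := starCover V W π)
    starKernel_injective (starKernel_exact hπ) (starCover_surjective hπ) hd
    inferInstance

/-- If `StarMod π` is projective, take a section of `starCover`. It lifts `t` to an element with
component `t` at the vertex `1`, which `b_j` sends to `b_j ⊗ t`, while `b_j` annihilates `t` in
`StarMod π` if `π_j t = 0`. -/
lemma injective_of_projective_starMod (hπ : ∀ j, Function.Surjective (π j))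
    (hp : Module.Projective (FamilyOp V W) (StarMod V W π)) (j : Fin m) :
    Function.Injective (π j) := by
  obtain ⟨s, hs⟩ := Module.projective_lifting_property (starCover V W π) LinearMap.id
    (starCover_surjective hπ)
  refine (injective_iff_map_eq_zero (π j)).2 fun t ht => ?_
  obtain ⟨y, t', z, hx⟩ := exists_eq_gMk (s (gMk 0 t 0))
  have h1 : (gMk y t' (bTensorMap π z) : StarMod V W π) = gMk 0 t 0 := by
    have := LinearMap.congr_fun hs (gMk 0 t 0)
    rwa [LinearMap.comp_apply, hx] at this
  obtain rfl : t' = t := (gMk_inj.1 h1).2.1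
  have h2 : famB V W j • (gMk 0 t' 0 : StarMod V W π) = 0 := by
    rw [famB_smul_gMk, ht, map_zero, gMk_zero]
  have h3 : (gMk 0 0 (bSingle V W j t') : ProjOne V W T) = gMk 0 0 0 := by
    have := congrArg s h2
    rwa [map_smul, hx, famB_smul_gMk, map_zero] at this
  have h4 := congrFun (gMk_inj.1 h3).2.2 j
  obtain ⟨φ, hφ⟩ | h0 : (∃ φ : T →ₗ[𝕜] 𝕜, φ t' = 1) ∨ t' = 0 := by
    by_cases h0 : t' = 0
    · exact Or.inr h0
    · exact Or.inl (Module.Projective.exists_dual_eq_one 𝕜 h0)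
  · have h5 := bCoord_bSingle (V := V) (W := W) (X := fun _ => T) j φ t'
    rw [(gMk_inj.1 h3).2.2, map_zero, hφ, one_smul] at h5
    exact (one_ne_zero (congrArg Prod.fst h5).symm).elim
  · exact h0

variable (V W) in
/-- The inclusion of the radical of `e_2 R_F`. -/
noncomputable def radTwoIncl :
    StarMod V W (fun j => (W j).mkQ) →ₗ[FamilyOp V W] ProjTwo V W :=
  gMap 0 LinearMap.id (fun _ => LinearMap.id) (fun _ _ => map_zero _) fun _ _ => rfl

variable (V W) in
/-- The projection of `e_2 R_F` onto its top. -/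
noncomputable def topTwoProj : ProjTwo V W →ₗ[FamilyOp V W] SimpleTwo V W :=
  gMap LinearMap.id 0 0 (fun _ _ => rfl) fun _ _ => rfl

lemma radTwoIncl_injective : Function.Injective (radTwoIncl V W) :=
  gMap_injective (Function.injective_of_subsingleton _) Function.injective_id
    fun _ => Function.injective_id

lemma topTwoProj_surjective : Function.Surjective (topTwoProj V W) :=
  gMap_surjective Function.surjective_id (Function.surjective_to_subsingleton _)
    fun _ => Function.surjective_to_subsingleton _

lemma radTwoIncl_exact : Function.Exact (radTwoIncl V W) (topTwoProj V W) := by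
  intro x
  obtain ⟨a, c, z, rfl⟩ := exists_eq_gMk x
  rw [topTwoProj, gMap_gMk, ← gMk_zero, gMk_inj]
  constructor
  · rintro ⟨ha, -, -⟩
    refine ⟨gMk 0 c z, ?_⟩
    rw [radTwoIncl, gMap_gMk, gMk_inj]
    exact ⟨ha.symm, rfl, bTensorMap_id z⟩
  · rintro ⟨x', hx'⟩
    obtain ⟨a', c', z', rfl⟩ := exists_eq_gMk x'
    exact ⟨(gMk_inj.1 hx').1.symm, rfl, Subsingleton.elim _ _⟩

lemma PdLT.simpleTwo {d : ℕ} (hd : PdLT (FamilyOp V W) (StarMod V W fun j => (W j).mkQ) d) :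
    PdLT (FamilyOp V W) (SimpleTwo V W) (d + 1) :=
  PdLT.right (f := radTwoIncl V W) (g := topTwoProj V W)
    radTwoIncl_injective radTwoIncl_exact topTwoProj_surjective hd
    inferInstance

lemma PdLT.radTwo {d : ℕ} (hd : PdLT (FamilyOp V W) (SimpleTwo V W) (d + 2)) :
    PdLT (FamilyOp V W) (StarMod V W fun j => (W j).mkQ) (d + 1) :=
  PdLT.left (f := radTwoIncl V W) (g := topTwoProj V W)
    radTwoIncl_injective radTwoIncl_exact topTwoProj_surjective hd
    inferInstance

/-- The linear map `V_i → C/W_j`, with kernel `V_i ∩ W_j`. -/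
def subQuot (V W : Fin m → Submodule 𝕜 (Fin n → 𝕜)) (i j : Fin m) :
    V i →ₗ[𝕜] (Fin n → 𝕜) ⧸ W j := (W j).mkQ ∘ₗ (V i).subtype

variable (V W) in
/-- The projective cover of `b_i R_F`. -/
noncomputable def bCover (i : Fin m) : ProjTwo V W →ₗ[FamilyOp V W] BMod V W i :=
  gLift (LinearMap.toSpanSingleton 𝕜 _ (bTop V W i))
    ((LinearMap.toSpanSingleton (FamilyOp V W) _ (bTop V W i)).restrictScalars 𝕜 ∘ₗ famC V W) 0
    (fun a => by
      rw [LinearMap.toSpanSingleton_apply, smul_comm, famE_smul_bTop, smul_zero])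
    (fun c => famE_one_famC_smul c (bTop V W i))
    (fun c a => by
      rw [LinearMap.toSpanSingleton_apply, smul_comm, LinearMap.flip_apply,
        LinearMap.lsmul_apply, map_smul]
      rfl)
    (fun j _ => famB_smul_bMod j i _)

variable (V W) in
/-- The inclusion of the kernel of `bCover`. -/
noncomputable def bKernel (i : Fin m) :
    StarMod V W (subQuot V W i) →ₗ[FamilyOp V W] ProjTwo V W :=
  gMap 0 (V i).subtype (fun _ => LinearMap.id) (fun _ _ => map_zero _) fun _ _ => rfl

lemma bCover_gMk (i : Fin m) (a : 𝕜) (c : Fin n → 𝕜)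
    (z : BTensor V W fun j => (Fin n → 𝕜) ⧸ W j) :
    bCover V W i (gMk a c z) = ((a, (V i).mkQ c) : 𝕜 × ((Fin n → 𝕜) ⧸ V i)) := by
  change a • bTop V W i + (famC V W c • bTop V W i + 0) = _
  rw [famC_smul_bTop]
  refine Prod.ext ?_ ?_
  · change a * 1 + (0 + 0) = a
    rw [mul_one, add_zero, add_zero]
  · change a • (0 : (Fin n → 𝕜) ⧸ V i) + ((V i).mkQ c + 0) = (V i).mkQ c
    rw [smul_zero, add_zero, zero_add]

lemma bKernel_injective (i : Fin m) : Function.Injective (bKernel V W i) :=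
  gMap_injective (Function.injective_of_subsingleton _) Subtype.val_injective
    fun _ => Function.injective_id

lemma bCover_surjective (i : Fin m) : Function.Surjective (bCover V W i) := by
  rintro ⟨a, d⟩
  obtain ⟨c, rfl⟩ := (V i).mkQ_surjective d
  exact ⟨gMk a c 0, bCover_gMk i a c 0⟩

lemma bKernel_exact (i : Fin m) : Function.Exact (bKernel V W i) (bCover V W i) := by
  intro x
  obtain ⟨a, c, z, rfl⟩ := exists_eq_gMk x
  rw [bCover_gMk]
  constructor
  · intro hx
    obtain ⟨ha, hc⟩ := Prod.mk_inj.1 hx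
    refine ⟨gMk 0 ⟨c, (Submodule.Quotient.mk_eq_zero _).1 hc⟩ z, ?_⟩
    exact gMk_inj.2 ⟨ha.symm, rfl, bTensorMap_id z⟩
  · rintro ⟨x', hx'⟩
    obtain ⟨a', c', z', rfl⟩ := exists_eq_gMk x'
    obtain ⟨ha, hc, -⟩ := gMk_inj.1 hx'
    refine Prod.ext ha.symm ?_
    change (V i).mkQ c = 0
    rw [← hc]
    exact (Submodule.Quotient.mk_eq_zero _).2 c'.2

lemma PdLT.bMod {d : ℕ} {i : Fin m} (hd : PdLT (FamilyOp V W) (StarMod V W (subQuot V W i)) d) :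
    PdLT (FamilyOp V W) (BMod V W i) (d + 1) :=
  PdLT.right (f := bKernel V W i) (g := bCover V W i)
    (bKernel_injective i) (bKernel_exact i) (bCover_surjective i) hd
    inferInstance

lemma PdLT.bMod_kernel {d : ℕ} {i : Fin m} (hd : PdLT (FamilyOp V W) (BMod V W i) (d + 2)) :
    PdLT (FamilyOp V W) (StarMod V W (subQuot V W i)) (d + 1) :=
  PdLT.left (f := bKernel V W i) (g := bCover V W i)
    (bKernel_injective i) (bKernel_exact i) (bCover_surjective i) hd
    inferInstance

/-- A section of `bCover` sends the generator to an element `x` with `x v ≠ 0` for all `v ≠ 0`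
in `C`, although the generator is annihilated by `V_i`. -/
lemma eq_bot_of_projective_bMod {i : Fin m}
    (hp : Module.Projective (FamilyOp V W) (BMod V W i)) : V i = ⊥ := by
  obtain ⟨s, hs⟩ := Module.projective_lifting_property (bCover V W i) LinearMap.id
    (bCover_surjective i)
  refine (Submodule.eq_bot_iff _).2 fun v hv => ?_
  obtain ⟨a, c, z, hx⟩ := exists_eq_gMk (s (bTop V W i))
  have h1 := LinearMap.congr_fun hs (bTop V W i)
  rw [LinearMap.comp_apply, hx, bCover_gMk] at h1
  obtain rfl : a = 1 := (Prod.mk_inj.1 h1).1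
  have h2 := congrArg s (famC_smul_bTop_eq_zero (V := V) (W := W) hv)
  rw [map_smul, hx, famC_smul_gMk, map_zero, LinearMap.flip_apply, LinearMap.lsmul_apply,
    one_smul] at h2
  exact (gMk_inj.1 (h2.trans gMk_zero.symm)).2.1

/-- `StarMod π` is an extension of `∏ j, b_j R_F ⊗ coker π_j` by the module of the maps `π_j` with
codomain restricted to their ranges. -/
lemma PdLT.starMod_of_range {d : ℕ}
    (h1 : PdLT (FamilyOp V W) (StarMod V W fun j => (π j).rangeRestrict) d)
    (h2 : PdLT (FamilyOp V W) (BTensor V W fun j => X j ⧸ LinearMap.range (π j)) d) :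
    PdLT (FamilyOp V W) (StarMod V W π) d := by
  let f : StarMod V W (fun j => (π j).rangeRestrict) →ₗ[FamilyOp V W] StarMod V W π :=
    gMap LinearMap.id LinearMap.id (fun j => (LinearMap.range (π j)).subtype) (fun _ _ => rfl)
      fun _ _ => rfl
  let q : BTensor V W X →ₗ[FamilyOp V W] BTensor V W fun j => X j ⧸ LinearMap.range (π j) :=
    bTensorMap fun j => (LinearMap.range (π j)).mkQ
  let g : StarMod V W π →ₗ[FamilyOp V W] BTensor V W fun j => X j ⧸ LinearMap.range (π j) :=
    gLift 0 0 q (fun _ => smul_zero _) (fun _ => smul_zero _) (fun _ _ => smul_zero _)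
      fun j t => by
        rw [bTensorMap_bSingle, Submodule.mkQ_apply,
          (Submodule.Quotient.mk_eq_zero _).2 (LinearMap.mem_range_self _ t), map_zero]
        exact smul_zero _
  have hg (y t z) : g (gMk y t z) = q z := by
    change 0 + (0 + q z) = q z
    rw [zero_add, zero_add]
  have hex := bTensorMap_exact (V := V) (W := W)
    (fun j => LinearMap.exact_subtype_mkQ (LinearMap.range (π j)))
    fun j => Submodule.mkQ_surjective _
  refine PdLT.middle (f := f) (g := g) (gMap_injective Function.injective_id Function.injective_id
    fun j => Subtype.val_injective) ?_ ?_ h1 h2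
  · intro x
    obtain ⟨y, t, z, rfl⟩ := exists_eq_gMk x
    rw [hg, hex z]
    constructor
    · rintro ⟨z', rfl⟩
      exact ⟨gMk y t z', rfl⟩
    · rintro ⟨x', hx'⟩
      obtain ⟨y', t', z', rfl⟩ := exists_eq_gMk x'
      exact ⟨z', (gMk_inj.1 hx').2.2⟩
  · intro z
    obtain ⟨z', rfl⟩ := bTensorMap_surjective (fun j => Submodule.mkQ_surjective _) z
    exact ⟨gMk 0 0 z', hg ..⟩

/-- The module of the maps `π_j` with codomain restricted to their ranges is a direct summand of
`StarMod π`. -/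
lemma PdLT.starMod_range {d : ℕ} (hd : PdLT (FamilyOp V W) (StarMod V W π) d) :
    PdLT (FamilyOp V W) (StarMod V W fun j => (π j).rangeRestrict) d := by
  -- `r j` is a projection of `X j` onto the range of `π j`
  choose r hr using fun j => (LinearMap.range (π j)).subtype.exists_leftInverse_of_injective
    (Submodule.ker_subtype _)
  have hr' (j : Fin m) (x : LinearMap.range (π j)) : r j x = x := LinearMap.congr_fun (hr j) x
  refine hd.of_retract
    (gMap LinearMap.id LinearMap.id (fun j => (LinearMap.range (π j)).subtype) (fun _ _ => rfl)
      fun _ _ => rfl)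
    (gMap LinearMap.id LinearMap.id r (fun _ _ => rfl)
      fun j t => (hr' j ((π j).rangeRestrict t)).symm) fun x => ?_
  obtain ⟨y, t, z, rfl⟩ := exists_eq_gMk x
  refine gMk_inj.2 ⟨rfl, rfl, ?_⟩
  refine LinearMap.congr_fun (g := LinearMap.id) (f := bTensorMap r ∘ₗ bTensorMap _)
    (bTensor_hom_ext fun j x => ?_) z
  rw [LinearMap.comp_apply, bTensorMap_bSingle, bTensorMap_bSingle, Submodule.subtype_apply, hr']
  rfl

end Syzygies

/-! ### Bounding the projective dimension of all modules -/

section General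

variable {𝕜 : Type u} [Field 𝕜] {n m : ℕ} {V W : Fin m → Submodule 𝕜 (Fin n → 𝕜)}
variable {N : Type u} [AddCommGroup N] [Module 𝕜 N] [Module (FamilyOp V W) N]
  [IsScalarTower 𝕜 (FamilyOp V W) N]

/-- A module concentrated at the vertex `1` is `StarMod` of zero maps. -/
lemma PdLT.of_famE_one {d : ℕ} (hd : ∀ j, PdLT (FamilyOp V W) (BMod V W j) d)
    (he : ∀ x : N, famE V W .one • x = x) (hb : ∀ i, ∀ x : N, famB V W i • x = 0) :
    PdLT (FamilyOp V W) N (d + 1) := by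
  have h : PdLT (FamilyOp V W)
      (StarMod V W fun _ : Fin m => (0 : N →ₗ[𝕜] PUnit.{u + 1})) (d + 1) :=
    PdLT.starMod (fun _ => Function.surjective_to_subsingleton _) (PdLT.bTensor fun j _ => hd j)
  let f : StarMod V W (fun _ : Fin m => (0 : N →ₗ[𝕜] PUnit.{u + 1})) →ₗ[FamilyOp V W] N :=
    gLift 0 LinearMap.id 0 (fun _ => smul_zero _) he (fun _ _ => smul_zero _) hb
  have hf (y t z) : f (gMk y t z) = t := by
    change 0 + (t + 0) = t
    rw [zero_add, add_zero]
  refine h.of_equiv (LinearEquiv.ofBijective f ⟨fun x x' hx => ?_, fun t => ⟨gMk 0 t 0, hf ..⟩⟩).symm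
  obtain ⟨y, t, z, rfl⟩ := exists_eq_gMk x
  obtain ⟨y', t', z', rfl⟩ := exists_eq_gMk x'
  rw [hf, hf] at hx
  exact gMk_inj.2 ⟨rfl, hx, Subsingleton.elim _ _⟩

/-- A module concentrated at the vertex `2` is a sum of copies of the simple module. -/
lemma PdLT.of_famE_two {d : ℕ} (hd : PdLT (FamilyOp V W) (SimpleTwo V W) d)
    (he : ∀ x : N, famE V W .one • x = 0) (hc : ∀ c, ∀ x : N, famC V W c • x = 0) :
    PdLT (FamilyOp V W) N d := by
  have hb (i : Fin m) (x : N) : famB V W i • x = 0 := by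
    rw [← famB_famE_one_smul, he, smul_zero]
  let i : N →ₗ[FamilyOp V W] SimpleTwo V W ⊗[𝕜] N :=
    FamilyOp.linearMap (TensorProduct.mk 𝕜 _ _ (gMk 1 0 0))
      (fun x => by
        rw [he, map_zero, TensorProduct.mk_apply, smul_tmul', famE_smul_gMk, smul_zero, gMk_zero,
          zero_tmul])
      (fun i x => by
        rw [hb, map_zero, TensorProduct.mk_apply, smul_tmul', famB_smul_gMk, map_zero,
          gMk_zero, zero_tmul])
      (fun c x => by
        rw [hc, map_zero, TensorProduct.mk_apply, smul_tmul', famC_smul_gMk, smul_zero]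
        exact (zero_tmul _ _).symm)
  let r : SimpleTwo V W ⊗[𝕜] N →ₗ[FamilyOp V W] N :=
    AlgebraTensorModule.lift (gLift (LinearMap.toSpanSingleton 𝕜 (N →ₗ[𝕜] N) LinearMap.id) 0 0
      (fun a => LinearMap.ext fun x => he (a • x)) (fun _ => smul_zero _)
      (fun c a => LinearMap.ext fun x => hc c (a • x)) (fun _ _ => smul_zero _))
  refine (hd.tensor N).of_retract i r fun x => ?_
  change (1 : 𝕜) • x + (0 + 0) = x
  rw [one_smul, add_zero, add_zero]

/-- If all `b_i` act by zero, then the component at the vertex `1` is a submodule, and the quotient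
is concentrated at the vertex `2`. -/
lemma PdLT.of_famB {d : ℕ} (h1 : ∀ j, PdLT (FamilyOp V W) (BMod V W j) d)
    (h2 : PdLT (FamilyOp V W) (SimpleTwo V W) (d + 1))
    (hb : ∀ i, ∀ x : N, famB V W i • x = 0) : PdLT (FamilyOp V W) N (d + 1) := by
  let p : Submodule (FamilyOp V W) N :=
    FamilyOp.submodule (LinearMap.ker (Algebra.lsmul 𝕜 𝕜 N (famE V W .two)))
      (fun x _ => famE_two_famE_one_smul x)
      (fun i x _ => by rw [hb]; exact Submodule.zero_mem _)
      (fun c x _ => famE_two_famC_smul c x)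
  have hp (x : N) : x ∈ p ↔ famE V W .two • x = 0 := Iff.rfl
  have hp1 : PdLT (FamilyOp V W) p (d + 1) :=
    PdLT.of_famE_one h1
      (fun x => Subtype.ext (by
        have h := (hp x).1 x.2
        rw [famE_two_smul, sub_eq_zero] at h
        exact h.symm))
      (fun i x => Subtype.ext (hb i x))
  have hp2 : PdLT (FamilyOp V W) (N ⧸ p) (d + 1) := by
    refine PdLT.of_famE_two h2 (fun x => ?_) (fun c x => ?_)
    all_goals
      obtain ⟨x, rfl⟩ := p.mkQ_surjective x
      rw [← map_smul, Submodule.mkQ_apply, Submodule.Quotient.mk_eq_zero, hp]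
    exacts [famE_two_famE_one_smul x, famE_two_famC_smul c x]
  exact PdLT.middle (f := p.subtype) (g := p.mkQ) Subtype.val_injective
    (LinearMap.exact_subtype_mkQ p) p.mkQ_surjective hp1 hp2

/-- The elements annihilated by all `b_i` and all `c b_i` form a submodule on which the `b_i` act by
zero; because of the relations `b c b' = 0`, they act by zero on the quotient as well. -/
lemma PdLT.of_bMod_of_simpleTwo {d : ℕ} (h1 : ∀ j, PdLT (FamilyOp V W) (BMod V W j) d)
    (h2 : PdLT (FamilyOp V W) (SimpleTwo V W) (d + 1)) : PdLT (FamilyOp V W) N (d + 1) := by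
  let p : Submodule (FamilyOp V W) N :=
    FamilyOp.submodule
      { carrier := {x | ∀ i, famB V W i • x = 0 ∧ ∀ c, famB V W i • famC V W c • x = 0}
        add_mem' := fun {x y} hx hy i => by
          refine ⟨?_, fun c => ?_⟩
          · rw [smul_add, (hx i).1, (hy i).1, add_zero]
          · rw [smul_add, smul_add, (hx i).2, (hy i).2, add_zero]
        zero_mem' := fun i => ⟨smul_zero _, fun c => by rw [smul_zero, smul_zero]⟩
        smul_mem' := fun a x hx i => by
          refine ⟨?_, fun c => ?_⟩
          · rw [smul_comm, (hx i).1, smul_zero]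
          · rw [smul_comm _ a, smul_comm _ a, (hx i).2, smul_zero] }
      (fun x hx i => ⟨by rw [famB_famE_one_smul, (hx i).1],
        fun c => by rw [famC_famE_one_smul, smul_zero]⟩)
      (fun j x hx i => ⟨famB_famB_smul j i x, fun c => famB_famC_famB_smul j i c x⟩)
      (fun c x hx i => ⟨(hx i).2 c, fun c' => by rw [famC_famC_smul, smul_zero]⟩)
  have hp1 : PdLT (FamilyOp V W) p (d + 1) :=
    PdLT.of_famB h1 h2 fun i x => Subtype.ext (x.2 i).1
  have hp2 : PdLT (FamilyOp V W) (N ⧸ p) (d + 1) := by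
    refine PdLT.of_famB h1 h2 fun i x => ?_
    obtain ⟨x, rfl⟩ := p.mkQ_surjective x
    rw [← map_smul, Submodule.mkQ_apply, Submodule.Quotient.mk_eq_zero]
    exact fun j => ⟨famB_famB_smul i j x, fun c => famB_famC_famB_smul i j c x⟩
  exact PdLT.middle (f := p.subtype) (g := p.mkQ) Subtype.val_injective
    (LinearMap.exact_subtype_mkQ p) p.mkQ_surjective hp1 hp2

end General

section GlobalDimension

variable {𝕜 : Type u} [Field 𝕜] {n m : ℕ} {V W : Fin m → Submodule 𝕜 (Fin n → 𝕜)}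

/-- A bound for the modules `b_j R_F` bounds the projective dimension of the simple module at the
vertex `2`, and thereby that of all modules. -/
lemma globalDimension_le {d : ℕ} (h : ∀ j, PdLT (FamilyOp V W) (BMod V W j) (d + 1)) :
    globalDimension (FamilyAlgebra V W) ≤ ((d + 2 : ℕ) : WithBot ℕ∞) := by
  have h1 : PdLT (FamilyOp V W) (StarMod V W fun j => (W j).mkQ) (d + 2) :=
    PdLT.starMod (fun j => (W j).mkQ_surjective) (PdLT.bTensor fun j _ => h j)
  refine iSup_le fun M => (projectiveDimension_le_iff M (d + 2)).2 ?_
  let : Module 𝕜 M := Module.compHom M (algebraMap 𝕜 (FamilyOp V W))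
  have : IsScalarTower 𝕜 (FamilyOp V W) M := ⟨fun a s x => by
    rw [Algebra.smul_def, mul_smul]; rfl⟩
  exact PdLT.of_bMod_of_simpleTwo (N := M) (fun j => (h j).mono (Nat.le_succ _)) h1.simpleTwo

/-- If `W_j ≠ 0`, then `b_j R_F` is a direct summand of the second syzygy of the simple module at the
vertex `2`. -/
lemma le_globalDimension {d : ℕ} {j : Fin m} (hW : W j ≠ ⊥)
    (h : ¬ PdLT (FamilyOp V W) (BMod V W j) (d + 1)) :
    ((d + 3 : ℕ) : WithBot ℕ∞) ≤ globalDimension (FamilyAlgebra V W) := by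
  refine le_trans ?_ (le_iSup _ (ModuleCat.of (FamilyOp V W) (SimpleTwo V W)))
  rw [projectiveDimension_ge_iff]
  intro h2
  have h3 : PdLT (FamilyOp V W) (SimpleTwo V W) (d + 3) := h2
  have h4 := h3.radTwo.starMod_kernel fun j => (W j).mkQ_surjective
  have : Nontrivial (LinearMap.ker (W j).mkQ) := by
    rw [Submodule.ker_mkQ]
    exact Submodule.nontrivial_iff_ne_bot.2 hW
  exact h h4.of_bTensor

end GlobalDimension

/-! ### Paths in a quiver -/

section Paths

variable {Q : Type v} [Quiver.{w} Q]

lemma Quiver.Path.exists_head {p q : Q} (γ : Quiver.Path p q) :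
    ∀ {L : ℕ}, γ.length = L + 1 →
      ∃ r, Nonempty (p ⟶ r) ∧ ∃ γ' : Quiver.Path r q, γ'.length = L := by
  induction γ with
  | nil => intro L h; simp at h
  | cons γ e ih =>
    intro L h
    rw [Quiver.Path.length_cons, Nat.add_right_cancel_iff] at h
    cases L with
    | zero =>
      obtain rfl := Quiver.Path.eq_of_length_zero γ h
      exact ⟨_, ⟨e⟩, Quiver.Path.nil, rfl⟩
    | succ L =>
      obtain ⟨r, hr, γ', h'⟩ := ih h
      exact ⟨r, hr, γ'.cons e, by rw [Quiver.Path.length_cons, h']⟩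

/-- Without oriented cycles, the set of vertices from which `q` is reached by a path of positive
length grows strictly along arrows. -/
lemma NoOrientedCycles.length_le [Finite Q] (hQ : NoOrientedCycles Q) {p q : Q}
    (γ : Quiver.Path p q) : γ.length ≤ Nat.card Q := by
  let s (q : Q) : Set Q := {r | ∃ δ : Quiver.Path r q, 0 < δ.length}
  suffices γ.length ≤ (s q).ncard from this.trans (Set.ncard_le_card _)
  induction γ with
  | nil => exact Nat.zero_le _
  | @cons b c γ e ih =>
    have h : s b ⊂ s c := by
      refine Set.ssubset_iff_exists.2 ⟨fun r ⟨δ, _⟩ => ⟨δ.cons e, Nat.succ_pos _⟩, b,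
        ⟨Quiver.Path.nil.cons e, Nat.succ_pos _⟩, fun ⟨δ, hδ⟩ => ?_⟩
      rw [hQ b δ] at hδ
      exact lt_irrefl _ hδ
    exact ih.trans_lt (Set.ncard_lt_ncard h)

lemma Quiver.Path.exists_length_eq_mul {q : Q} (γ : Quiver.Path q q) (N : ℕ) :
    ∃ δ : Quiver.Path q q, δ.length = N * γ.length := by
  induction N with
  | zero => exact ⟨Quiver.Path.nil, (Nat.zero_mul _).symm⟩
  | succ N ih =>
    obtain ⟨δ, hδ⟩ := ih
    exact ⟨δ.comp γ, by rw [Quiver.Path.length_comp, hδ, Nat.succ_mul]⟩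

end Paths

/-! ### Projective dimensions and paths in `Γ_F` -/

section GammaPaths

variable {𝕜 : Type u} [Field 𝕜] {n m : ℕ} {V W : Fin m → Submodule 𝕜 (Fin n → 𝕜)}

instance : Finite (GammaVertex V W) :=
  Finite.of_surjective (Sum.elim GammaVertex.b GammaVertex.v : Fin m ⊕ Fin m → _) (by
    rintro (i | i)
    exacts [⟨Sum.inl i, rfl⟩, ⟨Sum.inr i, rfl⟩])

lemma ker_subQuot_eq_bot_iff {i j : Fin m} :
    LinearMap.ker (subQuot V W i j) = ⊥ ↔ V i ⊓ W j = ⊥ := by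
  rw [subQuot, LinearMap.ker_comp, Submodule.ker_mkQ, ← disjoint_iff,
    Submodule.disjoint_iff_comap_eq_bot]

variable (V W) in
/-- The submodule `V_i R_F` of `e_2 R_F`, given by the maps of `V_i` onto its images in the spaces
`C/W_j`. -/
abbrev SubMod (i : Fin m) : Type u :=
  StarMod V W (T := V i) (X := fun j => LinearMap.range (subQuot V W i j))
    fun j => (subQuot V W i j).rangeRestrict

/-- The projective dimension of the module attached to a vertex of `Γ_F` is less than `d`. To `b_i`
belongs the module `b_i R_F`, and to `v_i` the module `V_i R_F`. -/
def NodePdLT : GammaVertex V W → ℕ → Prop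
  | .b i, d => PdLT (FamilyOp V W) (BMod V W i) d
  | .v i, d => PdLT (FamilyOp V W) (SubMod V W i) d

variable {k : ℕ} (hk : 0 < k) (hV : ∀ i, Module.finrank 𝕜 (V i) = k)
  (hW : ∀ i, Module.finrank 𝕜 ((Fin n → 𝕜) ⧸ W i) = k)

lemma nontrivial_ker_iff {i j : Fin m} :
    Nontrivial (LinearMap.ker (subQuot V W i j)) ↔
      0 < Module.finrank 𝕜 (V i ⊓ W j : Submodule 𝕜 (Fin n → 𝕜)) := by
  rw [Module.finrank_pos_iff, Submodule.nontrivial_iff_ne_bot, Submodule.nontrivial_iff_ne_bot,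
    Ne, Ne, ker_subQuot_eq_bot_iff]

include hV hW in
/-- As `V_i` and `C/W_j` have the same dimension, kernel and cokernel of `V_i → C/W_j` have the same
dimension. -/
lemma not_surjective_iff {i j : Fin m} :
    ¬ Function.Surjective (subQuot V W i j) ↔
      0 < Module.finrank 𝕜 (V i ⊓ W j : Submodule 𝕜 (Fin n → 𝕜)) := by
  rw [← LinearMap.injective_iff_surjective_of_finrank_eq_finrank ((hV i).trans (hW j).symm),
    ← LinearMap.ker_eq_bot, ← nontrivial_ker_iff, Submodule.nontrivial_iff_ne_bot]

include hk hV in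
lemma not_nodePdLT_zero (q : GammaVertex V W) : ¬ NodePdLT q 0 := by
  cases q with
  | b i =>
    intro h
    have := pdLT_zero_iff.1 h
    exact one_ne_zero (congrArg Prod.fst (Subsingleton.elim (bTop V W i) 0))
  | v i =>
    intro h
    have h1 := pdLT_zero_iff.1 h
    have h2 : Nontrivial (V i) := Module.finrank_pos_iff.1 ((hV i).symm ▸ hk)
    obtain ⟨t, ht⟩ := exists_ne (0 : V i)
    exact ht (gMk_inj.1 (h1.elim (gMk 0 t 0) (gMk 0 0 0))).2.1

include hk hV in
/-- The module at a vertex where an arrow starts is not projective. -/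
lemma not_nodePdLT_one {p q : GammaVertex V W} (a : GammaArrow V W p q) : ¬ NodePdLT p 1 := by
  intro h
  cases p with
  | b i =>
    have h1 := eq_bot_of_projective_bMod (pdLT_one_iff.1 h)
    have h2 := hV i
    rw [h1, finrank_bot] at h2
    exact hk.ne h2
  | v i =>
    cases a with
    | vb _ j s =>
      have h1 := injective_of_projective_starMod
        (fun j => (subQuot V W i j).surjective_rangeRestrict) (pdLT_one_iff.1 h) j
      have h2 := Submodule.nontrivial_iff_ne_bot.1 (nontrivial_ker_iff.2 (Fin.pos s))
      rw [← LinearMap.ker_eq_bot, LinearMap.ker_rangeRestrict] at h1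
      exact h2 h1

include hV hW in
/-- The module at the target of an arrow is a direct summand of the first syzygy of the module at
its source. -/
lemma NodePdLT.step {p q : GammaVertex V W} (a : GammaArrow V W p q) {d : ℕ}
    (h : NodePdLT p (d + 2)) :
    NodePdLT q (d + 1) := by
  cases a with
  | bv i => exact (PdLT.bMod_kernel h).starMod_range
  | bb i j s => exact (PdLT.bMod_kernel h).of_starMod ((not_surjective_iff hV hW).2 (Fin.pos s))
  | vb i j s =>
    have h1 := PdLT.starMod_kernel (fun j => (subQuot V W i j).surjective_rangeRestrict) h
    have : Nontrivial (LinearMap.ker (subQuot V W i j).rangeRestrict) := by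
      rw [LinearMap.ker_rangeRestrict]
      exact nontrivial_ker_iff.2 (Fin.pos s)
    exact h1.of_bTensor

include hk hV hW in
/-- The projective dimension is at least the length of every path starting at the vertex. -/
lemma not_nodePdLT_of_path (L : ℕ) : ∀ {p q : GammaVertex V W} (γ : Quiver.Path p q),
    γ.length = L → ¬ NodePdLT p L := by
  induction L with
  | zero => exact fun _ _ => not_nodePdLT_zero hk hV _
  | succ L ih =>
    intro p q γ hγ h
    obtain ⟨r, ⟨a⟩, γ', hγ'⟩ := γ.exists_head hγ
    cases L with
    | zero => exact not_nodePdLT_one hk hV a h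
    | succ L => exact ih γ' hγ' (h.step hV hW a)

include hV hW in
/-- The projective dimension is at most the supremum of the lengths of the paths starting at the
vertex. -/
lemma nodePdLT_of_forall_path (d : ℕ) : ∀ {p : GammaVertex V W},
    (∀ q, ∀ γ : Quiver.Path p q, γ.length < d) → NodePdLT p d := by
  induction d with
  | zero => exact fun h => (Nat.not_lt_zero _ (h _ Quiver.Path.nil)).elim
  | succ d ih =>
    intro p h
    have h1 {r : GammaVertex V W} (a : p ⟶ r) : NodePdLT r d := ih fun q γ => by
      have := h q (a.toPath.comp γ)
      rw [Quiver.Path.length_comp, Quiver.Path.length_toPath] at this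
      lia
    cases p with
    | b i =>
      refine PdLT.bMod (PdLT.starMod_of_range (h1 (GammaArrow.bv i)) (PdLT.bTensor fun j hj => ?_))
      refine h1 (GammaArrow.bb i j ⟨0, (not_surjective_iff hV hW).1 ?_⟩)
      rw [← LinearMap.range_eq_top]
      exact Submodule.Quotient.nontrivial_iff.1 hj
    | v i =>
      refine PdLT.starMod (fun j => (subQuot V W i j).surjective_rangeRestrict)
        (PdLT.bTensor fun j hj => h1 (GammaArrow.vb i j ⟨0, nontrivial_ker_iff.1 ?_⟩))
      rwa [LinearMap.ker_rangeRestrict] at hj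

include hk hV hW in
lemma le_globalDimension_of_path (hkn : k < n) {p q : GammaVertex V W} (γ : Quiver.Path p q)
    (hγ : 0 < γ.length) :
    ((γ.length + 2 : ℕ) : WithBot ℕ∞) ≤ globalDimension (FamilyAlgebra V W) := by
  have hW' (j : Fin m) : W j ≠ ⊥ := fun h => by
    have h1 := hW j
    have h2 := Submodule.finrank_quotient_add_finrank (W j)
    rw [h1, h, finrank_bot, Module.finrank_fin_fun] at h2
    lia
  have key (i : Fin m) (d : ℕ) (q : GammaVertex V W) (δ : Quiver.Path (GammaVertex.b i) q)
      (hδ : δ.length = d + 1) :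
      ((d + 3 : ℕ) : WithBot ℕ∞) ≤ globalDimension (FamilyAlgebra V W) :=
    le_globalDimension (hW' i) (not_nodePdLT_of_path hk hV hW _ δ hδ)
  obtain ⟨d, hd⟩ := Nat.exists_eq_add_of_lt hγ
  rw [zero_add] at hd
  cases p with
  | b i => rw [hd]; exact key i d q γ hd
  | v i =>
    -- a path that starts at `v_i` can be prolonged by the arrow `b_i → v_i`
    have a : GammaVertex.b i ⟶ (GammaVertex.v i : GammaVertex V W) := GammaArrow.bv i
    refine le_trans ?_ (key i γ.length q (a.toPath.comp γ) ?_)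
    · exact_mod_cast Nat.le_succ _
    · rw [Quiver.Path.length_comp, Quiver.Path.length_toPath, add_comm]

end GammaPaths

theorem mainTheorem3 {𝕜 : Type u} [Field 𝕜] [Infinite 𝕜] (n m k : ℕ) (hm : 1 ≤ m)
    (hk : 0 < k) (hkn : k < n) (V W : Fin m → Submodule 𝕜 (Fin n → 𝕜))
    (hV : ∀ i, Module.finrank 𝕜 (V i) = k)
    (hW : ∀ i, Module.finrank 𝕜 ((Fin n → 𝕜) ⧸ W i) = k) :
    (globalDimension (FamilyAlgebra V W) < ⊤ ↔ NoOrientedCycles (GammaVertex V W)) ∧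
    (NoOrientedCycles (GammaVertex V W) →
      ∃ l : ℕ, IsGreatest (pathLengths (GammaVertex V W)) l ∧
        globalDimension (FamilyAlgebra V W) = ((l + 2 : ℕ) : WithBot ℕ∞)) := by
  have finite_case : NoOrientedCycles (GammaVertex V W) →
      ∃ l : ℕ, IsGreatest (pathLengths (GammaVertex V W)) l ∧
        globalDimension (FamilyAlgebra V W) = ((l + 2 : ℕ) : WithBot ℕ∞) := by
    intro h
    have hbdd : BddAbove (pathLengths (GammaVertex V W)) := by
      refine ⟨Nat.card (GammaVertex V W), ?_⟩
      rintro _ ⟨p, q, γ, rfl⟩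
      exact h.length_le γ
    have a : GammaVertex.b ⟨0, hm⟩ ⟶ (GammaVertex.v ⟨0, hm⟩ : GammaVertex V W) := GammaArrow.bv _
    have hone : 1 ∈ pathLengths (GammaVertex V W) := ⟨_, _, a.toPath, rfl⟩
    have hmax : IsGreatest (pathLengths (GammaVertex V W)) (sSup (pathLengths (GammaVertex V W))) :=
      ⟨Nat.sSup_mem ⟨1, hone⟩ hbdd, fun _ hl => le_csSup hbdd hl⟩
    refine ⟨_, hmax, le_antisymm (globalDimension_le fun j => ?_) ?_⟩
    · exact nodePdLT_of_forall_path hV hW (p := GammaVertex.b j) _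
        fun q γ => Nat.lt_succ_of_le (hmax.2 ⟨_, _, γ, rfl⟩)
    · obtain ⟨p, q, γ, hγ⟩ := hmax.1
      have hpos := hmax.2 hone
      rw [← hγ] at hpos ⊢
      exact le_globalDimension_of_path hk hV hW hkn γ hpos
  refine ⟨⟨fun hfin q γ => ?_, fun h => ?_⟩, finite_case⟩
  -- the iterates of an oriented cycle are arbitrarily long paths
  · by_contra hγ
    have hγ' := Nat.pos_of_ne_zero hγ
    have hle (N : ℕ) : (N : WithBot ℕ∞) ≤ globalDimension (FamilyAlgebra V W) := by
      obtain ⟨δ, hδ⟩ := γ.exists_length_eq_mul (N + 1)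
      have h1 : N + 1 ≤ δ.length := hδ ▸ Nat.le_mul_of_pos_right _ hγ'
      refine le_trans ?_ (le_globalDimension_of_path hk hV hW hkn δ (by lia))
      exact_mod_cast (by lia : N ≤ δ.length + 2)
    generalize globalDimension (FamilyAlgebra V W) = x at hfin hle
    induction x with
    | bot => exact absurd (hle 0) (by simp)
    | coe x =>
      induction x with
      | top => exact lt_irrefl _ hfin
      | coe N =>
        have h1 : ((N + 1 : ℕ) : WithBot ℕ∞) ≤ ((N : ℕ) : WithBot ℕ∞) := hle (N + 1)
        have h2 : N + 1 ≤ N := by exact_mod_cast h1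
        lia
  · obtain ⟨l, -, hl⟩ := finite_case h
    rw [hl]
    exact WithBot.coe_lt_coe.2 (ENat.natCast_lt_top _)
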